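/- Let $p$ be a prime, let $t>2$ be an integer, and put $m=2t$, $q=p^m$. Let $\mathrm{Tr}$ be the trace function from $\mathbb F_q$ to $\mathbb F_p$ and let $\chi(x)=e^{2\pi i\,\mathrm{Tr}(x)/p}$ be the canonical additive character of $\mathbb F_q$. Let $\alpha$ be a generator of $\mathbb F_q^*$, let $\Delta=\langle\alpha^{p^t-1}\rangle$ (the subgroup of $\mathbb F_q^*$ of order $p^t+1$), and put $$S=\sum_{z\in\mathbb F_p^*}\ \sum_{x\in\Delta}\chi(zx).$$ For $a\in\mathbb F_p$ let $K_1(a)=\sum_{x\in\mathbb F_p^*}e^{2\pi i(ax+x^{-1})/p}$ be the Kloosterman sum over $\mathbb F_p$. Let $$D=\{(x,y)\in(\mathbb F_q\times\mathbb F_q)\setminus\{(0,0)\}:\ \mathrm{Tr}(x+y^{p^t-1})=0\},\qquad C_D=\{(\mathrm{Tr}(ax+by))_{(x,y)\in D}:\ a,b\in\mathbb F_q\}.$$ Then $C_D$ is a linear code over $\mathbb F_p$ of length $p^{2m-1}-1$ and dimension $2m$. Moreover $$S=\sum_{i=0}^{\lfloor t/2\rfloor}(-1)^{t-i}\,\frac{t}{t-i}\binom{t-i}{i}\,p^i\sum_{z\in\mathbb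 F_p^*}\bigl(K_1(z^2)\bigr)^{t-2i},$$ where a zeroth power is $1$. Put $$\begin{array}{ll} w_1=p^{2m-2}(p-1), & A_1=p^m(p^m-p+1)-1,\\[2pt] w_2=(p^{2m-2}-p^{m-2})(p-1)-p^{m-2}(p^t-1)S, & A_2=p-1,\\[2pt] w_3=(p^{2m-2}-p^{m-2})(p-1)-p^{m-2}\bigl(p^t(p-1)-S\bigr), & A_3=\dfrac{(p-1)(p^m-1)+(p^{t+1}-p^t-p+1)S}{p},\\[6pt] w_4=(p^{2m-2}-p^{m-2})(p-1)+p^{m-2}(p^t+S), & A_4=\dfrac{(p^2-2p+1)(p^m-1)-(p^{t+1}-p^t-p+1)S}{p}. \end{array}$$ All $w_i$ and $A_i$ are positive integers, and the weight distribution of $C_D$ is given by these weights and frequencies (together with the zero codeword): the weight enumerator of $C_D$, that is, the sum of $X^{\mathrm{wt}(c)}$ over all $c\in C_D$, equals $1+A_1X^{w_1}+A_2X^{w_2}+A_3X^{w_3}+A_4X^{w_4}$. If $S\neq p-1$, then $C_D$ is a four-weight code, i.e. exactly four nonzero Hamming weights occur in $C_D$. If $S=p-1$, then $w_2=w_3$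 and exactly three nonzero Hamming weights occur. -/

import Mathlib

noncomputable section

namespace KloostermanCode

/-- The canonical additive character of a finite field `E` of characteristic `p`:
`x ↦ exp (2πi Tr(x) / p)`, with `Tr` the absolute trace. -/
def canonicalChar (p : ℕ) [NeZero p] (E : Type*) [Field E] [Algebra (ZMod p) E] : AddChar E ℂ :=
  (ZMod.stdAddChar (N := p)).compAddMonoidHom (Algebra.trace (ZMod p) E).toAddMonoidHom

/-- The Kloosterman sum `K(a) = ∑_{x ∈ Eˣ} χ(a x + 1 / x)` over the finite field `E`. -/
def kloosterman (p : ℕ) [NeZero p] (E : Type*) [Field E] [Fintype E] [DecidableEq E]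
    [Algebra (ZMod p) E] (a : E) : ℂ :=
  ∑ x : Eˣ, canonicalChar p E (a * (x : E) + (x : E)⁻¹)

variable {F : Type*} [Field F] [Fintype F] [DecidableEq F]

/-- The subgroup of `Fˣ` generated by `α ^ (p ^ t - 1)`. -/
def circleSubgroup (p t : ℕ) (α : Fˣ) : Subgroup Fˣ :=
  Subgroup.zpowers (α ^ (p ^ t - 1))

/-- `S = ∑_{z ∈ F_pˣ} ∑_{x ∈ Δ} χ(z x)`, with `Δ` generated by `α ^ (p ^ t - 1)`. -/
def sumS (p t : ℕ) [Fact p.Prime] [Algebra (ZMod p) F] (α : Fˣ) : ℂ :=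
  ∑ z : (ZMod p)ˣ, ∑ᶠ x : circleSubgroup p t α,
    canonicalChar p F (algebraMap (ZMod p) F (z : ZMod p) * ((x : Fˣ) : F))

/-- The defining set `D = {(x, y) ≠ (0, 0) : Tr(x + y ^ (p ^ t - 1)) = 0}`. -/
def definingSet (p t : ℕ) (F : Type*) [Field F] [Fintype F] [DecidableEq F] [Algebra (ZMod p) F] :
    Finset (F × F) :=
  Finset.univ.filter fun d =>
    d ≠ (0, 0) ∧ Algebra.trace (ZMod p) F (d.1 + d.2 ^ (p ^ t - 1)) = 0

/-- The code `C_D = {(Tr(a x + b y))_{(x, y) ∈ D} : a, b ∈ F}`, with coordinates indexed by `D`. -/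
def codeOf (p : ℕ) [Algebra (ZMod p) F] (D : Finset (F × F)) :
    Submodule (ZMod p) (D → ZMod p) where
  carrier := {c | ∃ a b : F, c = fun d : D =>
    Algebra.trace (ZMod p) F (a * (d : F × F).1 + b * (d : F × F).2)}
  zero_mem' := ⟨0, 0, by funext d; simp⟩
  add_mem' := by
    rintro _ _ ⟨a, b, rfl⟩ ⟨a', b', rfl⟩
    refine ⟨a + a', b + b', ?_⟩
    funext d
    rw [Pi.add_apply, ← map_add]
    congr 1
    ring
  smul_mem' := by
    rintro r _ ⟨a, b, rfl⟩
    refine ⟨r • a, r • b, ?_⟩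
    funext d
    rw [Pi.smul_apply, ← map_smul]
    congr 1
    simp [smul_add]

/-- The number `A_k` of codewords of Hamming weight `k`. -/
def weightCount {p : ℕ} {ι : Type*} [Fintype ι] (C : Submodule (ZMod p) (ι → ZMod p)) (k : ℕ) : ℕ :=
  Set.ncard {c : ι → ZMod p | c ∈ C ∧ hammingNorm c = k}

/-- `C` is an `s`-weight code: exactly `s` nonzero Hamming weights occur among its codewords. -/
def IsWeightCode {p : ℕ} {ι : Type*} [Fintype ι] (s : ℕ)
    (C : Submodule (ZMod p) (ι → ZMod p)) : Prop :=
  Set.ncard {k : ℕ | k ≠ 0 ∧ weightCount C k ≠ 0} = s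

end KloostermanCode

end

/-!
# The weight distribution of the code `C_D`

Write `k = F_p`, `Q = p ^ t`, `E = F_Q`, `F = F_{Q²}`, and let `Δ ⊆ F` be the group of elements of
relative norm one over `E`, which has `Q + 1` elements. Everything depends on one number, the count
`N` of `u ∈ Δ` with `Tr u = 0` (`traceZeroCount`); orthogonality of characters gives
`S = p N - (Q + 1)`.

*The value of `S`.* Each `c ∈ E` is `v + v⁻¹` exactly twice with `v ∈ Eˣ` or `v ∈ Δ`
(`card_units_add_card_normOne`), so a character sum over `Δ` is the negative of a Kloosterman sum
over `E`. The latter is lifted from `k` by the method of `L`-functions: the function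
`kloostermanWeight` is multiplicative on monic polynomials, its sums over the polynomials of degree
`0, 1, 2` are `1, K, p` and vanish in higher degree, so that `L(T) = 1 + K T + p T²`. Comparing
coefficients in `T L' = (T L' / L) L`, where `T L' / L` has the Kloosterman sums over the extensions
of `k` as coefficients (`mul_sum_monicOfDegree`, `primePowerSum_eq_sum`), yields the recurrence of
the Dickson polynomials (`sum_addChar_trace_add_inv`), and Waring's formula
(`neg_one_pow_mul_dicksonValue`) makes these explicit.

*The weights.* The weight of the codeword of `(a, b)` is `p ^ (2m - 1)` minus the number of common
zeros `(x, y)` of `Tr (x + y ^ (Q - 1))` and `Tr (a x + b y)`. If `a ∉ k`, or `a = 0 ≠ b`, the two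
conditions are independent. If `a ∈ kˣ`, eliminating `x` leaves an equation in `y` alone, which is
solved along the orbits of `Eˣ`, where `y ^ (Q - 1)` is constant
(`card_trace_mul_eq_add_traceZeroCount`); the answer depends on `N`, on whether `b = 0`, and on
whether `Tr (b ^ (Q - 1)) = 0`.

*Positivity and distinctness.* These amount to `0 < N < Q + 1`, `N ≠ 1` and `N ≠ p ^ (t - 1)`. The
upper bound holds because `u ↦ u + u⁻¹` is at most two-to-one from `Δ` to `E`. For odd `p` the number
`N` is even, by `u ↦ -u`; for `p = 2` it is odd, by `u ↦ u⁻¹`. The lower bounds are bounds for sums of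
Dickson values `D_t` of the Kloosterman sums `K` over `k`. No square-root bound for `K` is needed: for
even `t` one has `D_t = D_{t/2}² - 2 p ^ (t/2)`, and for odd `t` either `|K| ≤ 2 √p`, in which case
`D_t` is of size `2 p ^ (t/2)`, or `D_t ≤ |K| ^ t`, which is controlled by `|K| ≤ p - 1` together with
the second moment of `K` (and, for `t = 3`, the first).
-/

namespace KloostermanCode

open Polynomial Finset

/-! ### The von Mangoldt identity for monic polynomials over a finite field -/

section VonMangoldt

variable (k : Type*) [Field k] [Fintype k] [DecidableEq k]

/-- The finite set of monic polynomials of degree `n` over a finite field. -/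
noncomputable def monicOfDegree (n : ℕ) : Finset k[X] :=
  univ.image fun v : Fin n → k => X ^ n + ofFn n v

/-- The finite set of monic irreducible polynomials of degree `n` over a finite field. -/
noncomputable def irreducibleOfDegree (n : ℕ) : Finset k[X] :=
  open Classical in (monicOfDegree k n).filter Irreducible

variable {k}

theorem mem_monicOfDegree {n : ℕ} {f : k[X]} :
    f ∈ monicOfDegree k n ↔ f.Monic ∧ f.natDegree = n := by
  simp only [monicOfDegree, mem_image, mem_univ, true_and]
  constructor
  · rintro ⟨v, rfl⟩
    have h := ofFn_degree_lt v
    refine ⟨monic_X_pow_add h, ?_⟩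
    rw [natDegree_add_eq_left_of_degree_lt (by simpa using h), natDegree_X_pow]
  · rintro ⟨hf, rfl⟩
    refine ⟨fun i => f.coeff i, ?_⟩
    ext j
    rw [coeff_add, coeff_X_pow]
    rcases lt_trichotomy j f.natDegree with h | h | h
    · rw [if_neg h.ne, ofFn_coeff_eq_val_of_lt _ h]; simp
    · rw [if_pos h, ofFn_coeff_eq_zero_of_ge _ h.ge, h, hf.coeff_natDegree, add_zero]
    · rw [if_neg h.ne', ofFn_coeff_eq_zero_of_ge _ h.le, coeff_eq_zero_of_natDegree_lt h, add_zero]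

theorem mem_irreducibleOfDegree {n : ℕ} {f : k[X]} :
    f ∈ irreducibleOfDegree k n ↔ f.Monic ∧ f.natDegree = n ∧ Irreducible f := by
  simp [irreducibleOfDegree, mem_monicOfDegree, and_assoc]

theorem sum_monicOfDegree {M : Type*} [AddCommMonoid M] (n : ℕ) (g : k[X] → M) :
    ∑ f ∈ monicOfDegree k n, g f = ∑ v : Fin n → k, g (X ^ n + ofFn n v) := by
  rw [monicOfDegree, sum_image]
  intro v _ w _ h
  exact injective_ofFn n (add_left_cancel h)

/-- Each prime power `P ^ e` dividing `f` with `e ≥ 1` contributes `deg P` to `deg f`. -/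
theorem natDegree_eq_sum_irreducible_pow_dvd {n : ℕ} {f : k[X]} (hf : f ∈ monicOfDegree k n) :
    n = ∑ d ∈ Icc 1 n, ∑ P ∈ irreducibleOfDegree k d,
      ∑ e ∈ Icc 1 n, open Classical in if P ^ e ∣ f then d else 0 := by
  classical
  obtain ⟨hm, hn⟩ := mem_monicOfDegree.1 hf
  have hf0 : f ≠ 0 := hm.ne_zero
  set s := UniqueFactorizationMonoid.normalizedFactors f with hs
  have hprod : s.prod = f := by
    rw [hs, UniqueFactorizationMonoid.prod_normalizedFactors_eq hf0, hm.normalize_eq_self]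
  have hsm : ∀ P ∈ s, P.Monic ∧ Irreducible P ∧ P ∣ f := fun P hP =>
    ⟨(Polynomial.mem_normalizedFactors_iff hf0).1 hP |>.2.1,
      (Polynomial.mem_normalizedFactors_iff hf0).1 hP |>.1,
      (Polynomial.mem_normalizedFactors_iff hf0).1 hP |>.2.2⟩
  have hdeg : n = ∑ P ∈ s.toFinset, s.count P * P.natDegree := by
    rw [← hn]
    conv_lhs => rw [← hprod]
    rw [natDegree_multiset_prod_of_monic _ fun P hP => (hsm P hP).1,
      Finset.sum_multiset_map_count]
    simp
  have hdisj : ∀ d ∈ Icc 1 n, ∀ P ∈ irreducibleOfDegree k d,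
      (∑ e ∈ Icc 1 n, if P ^ e ∣ f then d else 0) = s.count P * P.natDegree := by
    intro d hd P hP
    obtain ⟨hPm, hPd, hPi⟩ := mem_irreducibleOfDegree.1 hP
    have hcount : ∀ e, P ^ e ∣ f ↔ e ≤ s.count P := by
      intro e
      have h1 := UniqueFactorizationMonoid.emultiplicity_eq_count_normalizedFactors hPi hf0
      rw [hPm.normalize_eq_self] at h1
      rw [pow_dvd_iff_le_emultiplicity, h1, hs]
      norm_cast
    have hle : s.count P ≤ n := by
      have h1 := natDegree_le_of_dvd ((hcount _).2 le_rfl) hf0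
      rw [hPm.natDegree_pow, hPd, hn] at h1
      exact (Nat.le_mul_of_pos_right _ (mem_Icc.1 hd).1).trans h1
    simp only [hcount]
    rw [← sum_filter, sum_const, smul_eq_mul, hPd]
    congr 1
    rw [show (Icc 1 n).filter (fun e => e ≤ s.count P) = Icc 1 (s.count P) by
      ext e; simp only [mem_filter, mem_Icc]; omega]
    simp
  rw [sum_congr rfl fun d hd => sum_congr rfl (hdisj d hd)]
  rw [← sum_biUnion]
  · conv_lhs => rw [hdeg]
    apply sum_subset
    · intro P hP
      obtain ⟨h1, h2, h3⟩ := hsm P (Multiset.mem_toFinset.1 hP)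
      have := natDegree_le_of_dvd h3 hf0
      exact mem_biUnion.2 ⟨P.natDegree, mem_Icc.2 ⟨h2.natDegree_pos, hn ▸ this⟩,
        mem_irreducibleOfDegree.2 ⟨h1, rfl, h2⟩⟩
    · intro P _ hP
      rw [Multiset.mem_toFinset] at hP
      rw [Multiset.count_eq_zero_of_notMem hP, zero_mul]
  · intro a _ b _ hab
    refine disjoint_left.2 fun P h1 h2 => hab ?_
    rw [← (mem_irreducibleOfDegree.1 h1).2.1, (mem_irreducibleOfDegree.1 h2).2.1]

/-- The coefficients of the logarithmic derivative `T L'(T) / L(T)` of the Euler product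
`L(T) = ∏ (1 - l(P) T ^ deg P)⁻¹` over monic irreducible polynomials `P`. -/
noncomputable def primePowerSum (l : k[X] → ℂ) (n : ℕ) : ℂ :=
  ∑ x ∈ n.divisorsAntidiagonal, ∑ P ∈ irreducibleOfDegree k x.1, (x.1 : ℂ) * l P ^ x.2

/-- The identity `T L' = (T L' / L) L`, compared coefficientwise, for the `L`-series
`L(T) = ∑ l(f) T ^ deg f` of a multiplicative function on monic polynomials. -/
theorem mul_sum_monicOfDegree (l : k[X] → ℂ) (h1 : l 1 = 1)
    (hmul : ∀ f g : k[X], f.Monic → g.Monic → l (f * g) = l f * l g) (n : ℕ) :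
    (n : ℂ) * ∑ f ∈ monicOfDegree k n, l f =
      ∑ j ∈ Icc 1 n, primePowerSum l j * ∑ f ∈ monicOfDegree k (n - j), l f := by
  classical
  have hpow : ∀ (P : k[X]) (e : ℕ), P.Monic → l (P ^ e) = l P ^ e := by
    intro P e hP
    induction e with
    | zero => simpa using h1
    | succ e ih => rw [pow_succ, pow_succ, hmul _ _ (hP.pow e) hP, ih]
  -- `g ↦ P ^ e * g` parametrizes the polynomials of degree `n` divisible by `P ^ e`
  have hinner : ∀ d ∈ Icc 1 n, ∀ P ∈ irreducibleOfDegree k d, ∀ e ∈ Icc 1 n,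
      ∑ f ∈ monicOfDegree k n, (if P ^ e ∣ f then l f else 0) =
        if d * e ≤ n then l P ^ e * ∑ f ∈ monicOfDegree k (n - d * e), l f else 0 := by
    intro d hd P hP e he
    obtain ⟨hPm, hPd, hPi⟩ := mem_irreducibleOfDegree.1 hP
    have hPe : (P ^ e).natDegree = d * e := by rw [hPm.natDegree_pow, hPd, mul_comm]
    rw [← sum_filter]
    split_ifs with hde
    · rw [mul_sum]
      symm
      refine sum_bij (fun g _ => P ^ e * g) ?_ ?_ ?_ ?_
      · intro g hg
        obtain ⟨hg1, hg2⟩ := mem_monicOfDegree.1 hg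
        refine mem_filter.2 ⟨mem_monicOfDegree.2 ⟨(hPm.pow e).mul hg1, ?_⟩, dvd_mul_right _ _⟩
        rw [(hPm.pow e).natDegree_mul hg1, hPe, hg2]
        omega
      · intro g _ g' _ h
        exact mul_left_cancel₀ (hPm.pow e).ne_zero h
      · intro f hf
        obtain ⟨hf1, g, rfl⟩ := mem_filter.1 hf
        obtain ⟨hf2, hf3⟩ := mem_monicOfDegree.1 hf1
        have hgm : g.Monic := (hPm.pow e).of_mul_monic_left hf2
        refine ⟨g, mem_monicOfDegree.2 ⟨hgm, ?_⟩, rfl⟩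
        rw [(hPm.pow e).natDegree_mul hgm, hPe] at hf3
        omega
      · intro g hg
        rw [hmul _ _ (hPm.pow e) (mem_monicOfDegree.1 hg).1, hpow _ _ hPm]
    · rw [filter_eq_empty_iff.2, sum_empty]
      intro f hf hdvd
      obtain ⟨hf2, hf3⟩ := mem_monicOfDegree.1 hf
      have := natDegree_le_of_dvd hdvd hf2.ne_zero
      omega
  calc (n : ℂ) * ∑ f ∈ monicOfDegree k n, l f
      = ∑ f ∈ monicOfDegree k n, ∑ d ∈ Icc 1 n, ∑ P ∈ irreducibleOfDegree k d,
          ∑ e ∈ Icc 1 n, (d : ℂ) * if P ^ e ∣ f then l f else 0 := by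
        rw [mul_sum]
        refine sum_congr rfl fun f hf => ?_
        conv_lhs => rw [natDegree_eq_sum_irreducible_pow_dvd hf]
        push_cast
        simp only [sum_mul, ite_mul, zero_mul, mul_ite, mul_zero]
    _ = ∑ d ∈ Icc 1 n, ∑ e ∈ Icc 1 n, if d * e ≤ n then
          (∑ P ∈ irreducibleOfDegree k d, (d : ℂ) * l P ^ e) *
            ∑ f ∈ monicOfDegree k (n - d * e), l f else 0 := by
        rw [sum_comm]
        refine sum_congr rfl fun d hd => ?_
        rw [sum_comm]
        have hswap : ∀ P ∈ irreducibleOfDegree k d,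
            (∑ f ∈ monicOfDegree k n, ∑ e ∈ Icc 1 n, (d : ℂ) * if P ^ e ∣ f then l f else 0) =
            ∑ e ∈ Icc 1 n, if d * e ≤ n then
              ((d : ℂ) * l P ^ e) * ∑ f ∈ monicOfDegree k (n - d * e), l f else 0 := by
          intro P hP
          rw [sum_comm]
          refine sum_congr rfl fun e he => ?_
          rw [← mul_sum, hinner d hd P hP e he, mul_ite, mul_zero, mul_assoc]
        rw [sum_congr rfl hswap, sum_comm]
        refine sum_congr rfl fun e _ => ?_
        split_ifs
        · rw [sum_mul]
        · exact sum_const_zero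
    _ = _ := by
        simp only [primePowerSum, sum_mul (s := Nat.divisorsAntidiagonal _)]
        rw [← sum_product', ← sum_filter, sum_sigma']
        refine sum_nbij' (fun x => ⟨x.1 * x.2, x⟩) (fun y => y.2) ?_ ?_ ?_ ?_ ?_
        · rintro ⟨d, e⟩ h
          simp only [mem_filter, mem_product, mem_Icc] at h
          obtain ⟨⟨⟨h1, -⟩, h2, -⟩, h3⟩ := h
          simp only [mem_sigma, mem_Icc, Nat.mem_divisorsAntidiagonal, true_and]
          have := Nat.mul_pos h1 h2
          omega
        · rintro ⟨j, d, e⟩ h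
          simp only [mem_sigma, mem_Icc, Nat.mem_divisorsAntidiagonal] at h
          obtain ⟨⟨h1, h2⟩, rfl, h3⟩ := h
          have hd := Nat.pos_of_ne_zero (left_ne_zero_of_mul h3)
          have he := Nat.pos_of_ne_zero (right_ne_zero_of_mul h3)
          simp only [mem_filter, mem_product, mem_Icc]
          exact ⟨⟨⟨hd, (Nat.le_mul_of_pos_right _ he).trans h2⟩, he,
            (Nat.le_mul_of_pos_left _ hd).trans h2⟩, h2⟩
        · intro _ _; rfl
        · rintro ⟨j, d, e⟩ h
          simp only [mem_sigma, mem_Icc, Nat.mem_divisorsAntidiagonal] at h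
          obtain ⟨-, rfl, -⟩ := h
          rfl
        · intro _ _; rfl

end VonMangoldt

/-! ### Prime power sums as sums over an extension -/

section FiniteExtension

variable {k : Type*} [Field k] [Fintype k] [DecidableEq k]
  {E : Type*} [Field E] [Fintype E] [Algebra k E]

/-- A monic irreducible polynomial whose degree divides `[E : k]` has exactly as many roots
in `E` as its degree. -/
theorem card_filter_minpoly_eq {P : k[X]} (hP : P.Monic) (hPi : Irreducible P)
    (hd : P.natDegree ∣ Module.finrank k E) :
    open Classical in #{x : E | minpoly k x = P} = P.natDegree := by
  classical
  have : Fact (Irreducible P) := ⟨hPi⟩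
  have : Module.Finite k (AdjoinRoot P) := (AdjoinRoot.powerBasis hP.ne_zero).finite
  have hfr : Module.finrank k (AdjoinRoot P) = P.natDegree :=
    (AdjoinRoot.powerBasis hP.ne_zero).finrank
  obtain ⟨φ⟩ := FiniteField.nonempty_algHom_of_finrank_dvd (F := k) (K := AdjoinRoot P) (L := E)
    (hfr ▸ hd)
  -- the residue field of `P` embeds into `E`, which gives one root; normality gives the others
  have hroot : aeval (φ (AdjoinRoot.root P)) P = 0 := by
    rw [aeval_algHom_apply, AdjoinRoot.aeval_eq, AdjoinRoot.mk_self, map_zero]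
  have hmin := minpoly.eq_of_irreducible_of_monic hPi hroot hP
  have hsplit : (P.map (algebraMap k E)).Splits := by
    rw [hmin]
    exact Normal.splits inferInstance _
  rw [← card_rootSet_eq_natDegree (K := E) (PerfectField.separable_of_irreducible hPi) hsplit,
    Fintype.card_of_subtype]
  intro x
  rw [mem_filter, mem_rootSet_of_ne hP.ne_zero]
  simp only [mem_univ, true_and]
  constructor
  · rintro rfl
    exact minpoly.aeval _ _
  · intro h
    exact (minpoly.eq_of_irreducible_of_monic hPi h hP).symm

/-- The prime power sums are character sums over the points of the extension of degree `n`. -/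
theorem primePowerSum_eq_sum (l : k[X] → ℂ) :
    primePowerSum l (Module.finrank k E) =
      ∑ x : E, l (minpoly k x) ^ (Module.finrank k E / (minpoly k x).natDegree) := by
  classical
  have hn : Module.finrank k E ≠ 0 := Module.finrank_pos.ne'
  set n := Module.finrank k E
  have hdvd : ∀ x : E, (minpoly k x).natDegree ∣ n := fun x =>
    minpoly.degree_dvd (IsIntegral.of_finite k x)
  have hpos : ∀ x : E, 0 < (minpoly k x).natDegree := fun x =>
    minpoly.natDegree_pos (IsIntegral.of_finite k x)
  rw [primePowerSum, sum_sigma']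
  rw [← sum_fiberwise_of_maps_to (s := univ)
    (t := (n.divisorsAntidiagonal.sigma fun x => irreducibleOfDegree k x.1))
    (g := fun x : E => ⟨((minpoly k x).natDegree, n / (minpoly k x).natDegree), minpoly k x⟩)]
  · refine sum_congr rfl ?_
    rintro ⟨⟨d, e⟩, P⟩ h
    simp only [mem_sigma, Nat.mem_divisorsAntidiagonal, mem_irreducibleOfDegree] at h
    obtain ⟨⟨hde, -⟩, hPm, hPd, hPi⟩ := h
    have hd0 : 0 < d := Nat.pos_of_ne_zero (by rintro rfl; simp at hde; omega)
    have he : n / d = e := by rw [← hde, Nat.mul_div_cancel_left _ hd0]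
    have hfil : (univ.filter fun x : E => (⟨((minpoly k x).natDegree,
        n / (minpoly k x).natDegree), minpoly k x⟩ : (_ : ℕ × ℕ) × k[X]) = ⟨(d, e), P⟩) =
        univ.filter fun x : E => minpoly k x = P := by
      ext x
      simp only [mem_filter, mem_univ, true_and, Sigma.mk.injEq, heq_eq_eq, Prod.mk.injEq]
      constructor
      · exact fun h => h.2
      · rintro h
        rw [h, hPd, he]
        exact ⟨⟨rfl, rfl⟩, rfl⟩
    rw [hfil]
    rw [sum_congr rfl (g := fun _ => l P ^ e), sum_const,
      card_filter_minpoly_eq hPm hPi (by rw [hPd]; exact ⟨e, hde.symm⟩), hPd, nsmul_eq_mul]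
    intro x hx
    rw [(mem_filter.1 hx).2, hPd, he]
  · intro x _
    simp only [mem_sigma, Nat.mem_divisorsAntidiagonal, mem_irreducibleOfDegree]
    exact ⟨⟨Nat.mul_div_cancel' (hdvd x), hn⟩, minpoly.monic (IsIntegral.of_finite k x), trivial,
      minpoly.irreducible (IsIntegral.of_finite k x)⟩

end FiniteExtension

/-! ### The Euler factors of the Kloosterman sum -/

section KloostermanWeight

variable {k : Type*} [Field k]

section

variable [DecidableEq k]

/-- The multiplicative function on monic polynomials whose Euler product is the `L`-function of the
Kloosterman sum: `ψ` of the sum of the roots plus the sum of the inverses of the roots, and zero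
when zero is a root. -/
noncomputable def kloostermanWeight (ψ : AddChar k ℂ) (f : k[X]) : ℂ :=
  if f.coeff 0 = 0 then 0 else ψ (-(f.nextCoeff + f.coeff 1 / f.coeff 0))

theorem kloostermanWeight_one (ψ : AddChar k ℂ) : kloostermanWeight ψ 1 = 1 := by
  have : (1 : k[X]).nextCoeff = 0 := nextCoeff_C_eq_zero (1 : k)
  simp [kloostermanWeight, this, coeff_one]

theorem kloostermanWeight_mul (ψ : AddChar k ℂ) (f g : k[X]) (hf : f.Monic) (hg : g.Monic) :
    kloostermanWeight ψ (f * g) = kloostermanWeight ψ f * kloostermanWeight ψ g := by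
  simp only [kloostermanWeight, mul_coeff_zero, mul_coeff_one, hf.nextCoeff_mul hg, mul_eq_zero]
  by_cases h1 : f.coeff 0 = 0
  · simp [h1]
  by_cases h2 : g.coeff 0 = 0
  · simp [h2]
  rw [if_neg (by tauto), if_neg h1, if_neg h2, ← AddChar.map_add_eq_mul]
  congr 1
  field_simp
  ring

variable [Fintype k]

theorem sum_kloostermanWeight_zero (ψ : AddChar k ℂ) :
    ∑ f ∈ monicOfDegree k 0, kloostermanWeight ψ f = 1 := by
  rw [sum_monicOfDegree]
  simp [kloostermanWeight_one, ofFn_zero']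

theorem sum_kloostermanWeight_one (ψ : AddChar k ℂ) :
    ∑ f ∈ monicOfDegree k 1, kloostermanWeight ψ f = ∑ x : kˣ, ψ ((x : k) + (x : k)⁻¹) := by
  have hpoly : ∀ a : k, (X ^ 1 + ofFn 1 (fun _ => a) : k[X]) = X + C a := by
    intro a
    rw [ofFn_eq_sum_monomial]
    simp
  rw [sum_monicOfDegree, ← (Equiv.funUnique (Fin 1) k).symm.sum_comp]
  have h : ∀ a : k, kloostermanWeight ψ (X ^ 1 + ofFn 1 ((Equiv.funUnique (Fin 1) k).symm a)) =
      if a = 0 then 0 else ψ (-a + (-a)⁻¹) := by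
    intro a
    have : (Equiv.funUnique (Fin 1) k).symm a = fun _ => a := rfl
    rw [this, hpoly, kloostermanWeight, nextCoeff_X_add_C]
    simp [coeff_C, inv_neg, add_comm]
  rw [sum_congr rfl fun a _ => h a, ← Equiv.sum_comp (Equiv.neg k)]
  simp only [Equiv.neg_apply, neg_eq_zero, neg_neg]
  rw [← sum_filter_add_sum_filter_not univ (fun x : k => x = 0),
    sum_eq_zero (s := univ.filter fun x : k => x = 0), zero_add]
  · symm
    refine sum_bij (fun x _ => (x : k)) (fun x _ => by simp) (fun x _ y _ h => Units.ext h) ?_ ?_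
    · intro b hb
      exact ⟨Units.mk0 b (mem_filter.1 hb).2, mem_univ _, rfl⟩
    · intro x _
      rw [if_neg x.ne_zero]
  · intro x hx
    rw [if_pos (mem_filter.1 hx).2]

theorem sum_kloostermanWeight_two (ψ : AddChar k ℂ) (hψ : ψ.IsPrimitive) :
    ∑ f ∈ monicOfDegree k 2, kloostermanWeight ψ f = Fintype.card k := by
  have hval : ∀ a b : k, kloostermanWeight ψ (X ^ 2 + ofFn 2 ![b, a]) =
      if b = 0 then 0 else ψ (a * (-(1 + b⁻¹))) := by
    intro a b
    have hd : (X ^ 2 + ofFn 2 ![b, a] : k[X]).natDegree = 2 :=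
      (mem_monicOfDegree.1 (mem_image_of_mem _ (mem_univ _))).2
    rw [kloostermanWeight, nextCoeff_of_natDegree_pos (by omega), hd]
    simp only [coeff_add, coeff_X_pow]
    rw [ofFn_coeff_eq_val_of_lt _ (by omega : 0 < 2), ofFn_coeff_eq_val_of_lt _ (by omega : 1 < 2)]
    simp only [OfNat.zero_ne_ofNat, if_false, zero_add, Fin.zero_eta, Matrix.cons_val_zero,
      OfNat.one_ne_ofNat, Fin.mk_one, Matrix.cons_val_one, Nat.reduceSub]
    congr 2
    rw [div_eq_mul_inv]
    ring
  rw [sum_monicOfDegree, ← (finTwoArrowEquiv k).symm.sum_comp, Fintype.sum_prod_type]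
  simp only [finTwoArrowEquiv_symm_apply, hval]
  -- the sum over the middle coefficient vanishes unless the constant term is `-1`
  rw [sum_eq_single (-1 : k)]
  · simp
  · intro b _ hb
    by_cases hb0 : b = 0
    · simp [hb0]
    · simp only [if_neg hb0]
      rw [AddChar.sum_mulShift _ hψ, if_neg, Nat.cast_zero]
      intro h
      apply hb
      have h2 : b⁻¹ = -1 := by linear_combination -h
      rw [← inv_inv b, h2, inv_neg, inv_one]
  · simp

/-- In degree at least three the coefficient of `X` can be shifted without changing the sum of
the roots, so the weights cancel. -/
theorem sum_kloostermanWeight_eq_zero (ψ : AddChar k ℂ) (hψ : ψ ≠ 0) {n : ℕ} (hn : 3 ≤ n) :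
    ∑ f ∈ monicOfDegree k n, kloostermanWeight ψ f = 0 := by
  obtain ⟨s, hs⟩ := AddChar.ne_zero_iff.1 hψ
  have hc1 : ∀ (f : k[X]) (r : k), (f + C (r * f.coeff 0) * X).coeff 1 =
      f.coeff 1 + r * f.coeff 0 := by intro f r; simp
  have hc0 : ∀ (f : k[X]) (r : k), (f + C (r * f.coeff 0) * X).coeff 0 = f.coeff 0 := by
    intro f r; simp
  have hmem : ∀ (r : k), ∀ f ∈ monicOfDegree k n, f + C (r * f.coeff 0) * X ∈
      monicOfDegree k n := by
    intro r f hf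
    obtain ⟨hm, hd⟩ := mem_monicOfDegree.1 hf
    have hlt : (C (r * f.coeff 0) * X : k[X]).degree < f.degree := by
      rw [degree_eq_natDegree hm.ne_zero, hd]
      refine (degree_C_mul_X_le _).trans_lt ?_
      exact_mod_cast (by omega : 1 < n)
    exact mem_monicOfDegree.2 ⟨hm.add_of_left hlt, by
      rw [natDegree_add_eq_left_of_degree_lt hlt, hd]⟩
  have hnext : ∀ (r : k), ∀ f ∈ monicOfDegree k n,
      (f + C (r * f.coeff 0) * X).nextCoeff = f.nextCoeff := by
    intro r f hf
    have h1 := (mem_monicOfDegree.1 (hmem r f hf)).2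
    have h2 := (mem_monicOfDegree.1 hf).2
    rw [nextCoeff_of_natDegree_pos (by omega), nextCoeff_of_natDegree_pos (by omega), h1, h2]
    have : (1 : ℕ) ≠ n - 1 := by omega
    rw [coeff_add, coeff_C_mul, coeff_X, if_neg this, mul_zero, add_zero]
  have hinv : ∀ (r : k) (f : k[X]), f + C (r * f.coeff 0) * X +
      C (-r * (f + C (r * f.coeff 0) * X).coeff 0) * X = f := by
    intro r f
    rw [hc0, neg_mul, C_neg]
    ring
  have key : ∑ f ∈ monicOfDegree k n, kloostermanWeight ψ f =
      ∑ f ∈ monicOfDegree k n, ψ s * kloostermanWeight ψ f := by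
    symm
    refine sum_nbij' (fun f => f + C (-s * f.coeff 0) * X) (fun f => f + C (s * f.coeff 0) * X)
      (hmem _) (hmem _) ?_ ?_ ?_
    · intro f _
      have := hinv (-s) f
      rwa [neg_neg] at this
    · intro f _
      exact hinv s f
    · intro f hf
      simp only [kloostermanWeight]
      rw [hnext _ f hf, hc0, hc1]
      split_ifs with h0
      · rw [mul_zero]
      · rw [← AddChar.map_add_eq_mul]
        congr 1
        field_simp
        ring
  rw [← mul_sum] at key
  have h2 : (ψ s - 1) * ∑ f ∈ monicOfDegree k n, kloostermanWeight ψ f = 0 := by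
    linear_combination -key
  exact (mul_eq_zero.1 h2).resolve_left (sub_ne_zero.2 hs)

end

variable {E : Type*} [Field E] [Algebra k E] [FiniteDimensional k E]

/-- The minimal polynomial of `x⁻¹` is the reversed minimal polynomial of `x`, made monic. -/
theorem minpoly_inv {x : E} (hx : x ≠ 0) :
    minpoly k x⁻¹ = C ((minpoly k x).coeff 0)⁻¹ * (minpoly k x).reverse := by
  have hdvd : ∀ y : E, y ≠ 0 → minpoly k y⁻¹ ∣ (minpoly k y).reverse := by
    intro y hy
    apply minpoly.dvd
    have h := minpoly.aeval k y
    have : Invertible y := invertibleOfNonzero hy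
    rw [aeval_def, ← invOf_eq_inv, eval₂_reverse_eq_zero_iff]
    exact h
  have hne : ∀ y : E, minpoly k y ≠ 0 := fun y => minpoly.ne_zero (IsIntegral.of_finite k y)
  have hle : ∀ y : E, y ≠ 0 → (minpoly k y⁻¹).natDegree ≤ (minpoly k y).natDegree := by
    intro y hy
    exact (natDegree_le_of_dvd (hdvd y hy) (by simpa using hne y)).trans (reverse_natDegree_le _)
  have hc0 : (minpoly k x).coeff 0 ≠ 0 := by
    rwa [Ne, minpoly.coeff_zero_eq_zero (IsIntegral.of_finite k x)]
  have htr : (minpoly k x).reverse.leadingCoeff = (minpoly k x).coeff 0 := by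
    rw [reverse_leadingCoeff, trailingCoeff_eq_coeff_zero hc0]
  refine (eq_of_monic_of_dvd_of_natDegree_le (minpoly.monic (IsIntegral.of_finite k _)) ?_ ?_
    ?_).symm
  · rw [Monic, leadingCoeff_mul, leadingCoeff_C, htr, inv_mul_cancel₀ hc0]
  · exact (hdvd x hx).mul_left _
  · rw [natDegree_C_mul (inv_ne_zero hc0)]
    refine (reverse_natDegree_le _).trans ?_
    have := hle x⁻¹ (inv_ne_zero hx)
    rwa [inv_inv] at this

theorem nextCoeff_minpoly_inv {x : E} (hx : x ≠ 0) :
    (minpoly k x⁻¹).nextCoeff = (minpoly k x).coeff 1 / (minpoly k x).coeff 0 := by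
  have hc0 : (minpoly k x).coeff 0 ≠ 0 := by
    rwa [Ne, minpoly.coeff_zero_eq_zero (IsIntegral.of_finite k x)]
  have hpos := minpoly.natDegree_pos (IsIntegral.of_finite k x)
  have hd : (minpoly k x⁻¹).natDegree = (minpoly k x).natDegree := by
    rw [minpoly_inv hx, natDegree_C_mul (inv_ne_zero hc0), reverse_natDegree,
      natTrailingDegree_eq_zero.2 (Or.inr hc0), Nat.sub_zero]
  rw [nextCoeff_of_natDegree_pos (by omega), hd, minpoly_inv hx, coeff_C_mul, coeff_reverse,
    revAt_le (by omega), div_eq_inv_mul]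
  congr 2
  omega

theorem kloostermanWeight_minpoly_pow [DecidableEq k] [DecidableEq E] (ψ : AddChar k ℂ) (x : E) :
    kloostermanWeight ψ (minpoly k x) ^ (Module.finrank k E / (minpoly k x).natDegree) =
      if x = 0 then 0 else ψ (Algebra.trace k E (x + x⁻¹)) := by
  have hint := IsIntegral.of_finite k x
  have hpos := minpoly.natDegree_pos hint
  have hr : ∀ y : E, Module.finrank k E / (minpoly k y).natDegree =
      Module.finrank (IntermediateField.adjoin k {y}) E := by
    intro y
    rw [← IntermediateField.adjoin.finrank (IsIntegral.of_finite k y),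
      ← Module.finrank_mul_finrank k (IntermediateField.adjoin k {y}) E]
    exact Nat.mul_div_cancel_left _ Module.finrank_pos
  rw [kloostermanWeight]
  simp only [minpoly.coeff_zero_eq_zero hint]
  split_ifs with hx
  · apply zero_pow
    have := Nat.div_pos (Nat.le_of_dvd Module.finrank_pos (minpoly.degree_dvd hint)) hpos
    omega
  · have hc0 : (minpoly k x).coeff 0 ≠ 0 := by
      rwa [Ne, minpoly.coeff_zero_eq_zero (IsIntegral.of_finite k x)]
    have hd : (minpoly k x⁻¹).natDegree = (minpoly k x).natDegree := by
      rw [minpoly_inv hx, natDegree_C_mul (inv_ne_zero hc0), reverse_natDegree,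
        natTrailingDegree_eq_zero.2 (Or.inr hc0), Nat.sub_zero]
    rw [map_add, trace_eq_finrank_mul_minpoly_nextCoeff, trace_eq_finrank_mul_minpoly_nextCoeff,
      ← hr, ← hr, hd, nextCoeff_minpoly_inv hx, ← AddChar.map_nsmul_eq_pow]
    congr 1
    rw [nsmul_eq_mul]
    ring

end KloostermanWeight

/-! ### Dickson values: Waring's formula and bounds -/

section Dickson

/-- The value at `r` of the Dickson polynomial of the first kind with parameter `a`; if
`r = u + v` and `a = u * v`, this is `u ^ n + v ^ n`. -/
noncomputable def dicksonValue {R : Type*} [CommRing R] (a r : R) (n : ℕ) : R :=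
  (dickson 1 a n).eval r

section Ring

variable {R : Type*} [CommRing R] (a r : R)

theorem dicksonValue_zero : dicksonValue a r 0 = 2 := by
  simp only [dicksonValue, dickson_zero]
  norm_num

theorem dicksonValue_one : dicksonValue a r 1 = r := by
  simp [dicksonValue, dickson_one]

theorem dicksonValue_add_two (n : ℕ) :
    dicksonValue a r (n + 2) = r * dicksonValue a r (n + 1) - a * dicksonValue a r n := by
  simp [dicksonValue, dickson_add_two]

theorem dicksonValue_three : dicksonValue a r 3 = r ^ 3 - 3 * a * r := by
  rw [show 3 = 1 + 2 from rfl, dicksonValue_add_two, show 1 + 1 = 0 + 2 from rfl,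
    dicksonValue_add_two, zero_add, dicksonValue_zero, dicksonValue_one]
  ring

theorem dicksonValue_neg (n : ℕ) : dicksonValue a (-r) n = (-1) ^ n * dicksonValue a r n := by
  induction n using Nat.twoStepInduction with
  | zero => simp [dicksonValue_zero]
  | one => simp [dicksonValue_one]
  | more n h1 h2 =>
    rw [dicksonValue_add_two, dicksonValue_add_two, h1, h2]
    ring

/-- The Lucas triangle: Pascal's rule started from a column with `2` at the apex. Its entries are
the absolute values of the coefficients of the Dickson polynomials. -/
def lucasTriangle : ℕ → ℕ → ℕ
  | 0, 0 => 2
  | 0, _ + 1 => 0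
  | _ + 1, 0 => 1
  | i + 1, j + 1 => lucasTriangle i (j + 1) + lucasTriangle i j

theorem lucasTriangle_eq_zero {i j : ℕ} (h : i < j) : lucasTriangle i j = 0 := by
  induction i generalizing j with
  | zero => obtain ⟨j, rfl⟩ := Nat.exists_eq_add_of_lt h; simp [lucasTriangle]
  | succ i ih =>
    obtain ⟨j, rfl⟩ : ∃ l, j = l + 1 := ⟨j - 1, by omega⟩
    rw [lucasTriangle, ih (by omega), ih (by omega)]

theorem mul_lucasTriangle (i j : ℕ) : i * lucasTriangle i j = (i + j) * i.choose j := by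
  induction i generalizing j with
  | zero => cases j <;> simp
  | succ i ih =>
    cases j with
    | zero => simp [lucasTriangle]
    | succ j =>
      rw [lucasTriangle]
      rcases Nat.eq_zero_or_pos i with rfl | hi
      · rcases j with _ | j
        · simp [lucasTriangle]
        · simp [lucasTriangle, Nat.choose_eq_zero_of_lt (show 1 < j + 1 + 1 by omega)]
      · have h1 := ih (j + 1)
        have h2 := ih j
        have h3 : (i.choose (j + 1) : ℤ) * (j + 1) = i.choose j * (i - j) := by
          rcases le_or_gt j i with h | h
          · have := Nat.choose_succ_right_eq i j
            zify [h] at this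
            exact this
          · rw [Nat.choose_eq_zero_of_lt h, Nat.choose_eq_zero_of_lt (by omega)]
            simp
        apply Nat.eq_of_mul_eq_mul_left hi
        rw [Nat.choose_succ_succ]
        zify at h1 h2 ⊢
        linear_combination (i + 1 : ℤ) * h1 + (i + 1 : ℤ) * h2 + h3

theorem dicksonValue_eq_sum_antidiagonal (n : ℕ) :
    dicksonValue a r n =
      ∑ x ∈ antidiagonal n, (lucasTriangle x.1 x.2 : R) * (-a) ^ x.2 * r ^ (x.1 - x.2) := by
  induction n using Nat.twoStepInduction with
  | zero => simp [dicksonValue_zero, lucasTriangle]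
  | one => simp [dicksonValue_one, Nat.antidiagonal_succ, lucasTriangle]
  | more n h1 h2 =>
    rw [dicksonValue_add_two, h1, h2, Nat.antidiagonal_succ_succ', Nat.antidiagonal_succ']
    simp only [sum_cons, sum_map, Function.Embedding.coe_prodMap, Prod.map_fst, Prod.map_snd,
      Function.Embedding.coeFn_mk, Function.Embedding.refl_apply, Nat.succ_eq_add_one,
      Nat.add_sub_add_right, lucasTriangle, Nat.cast_add, Nat.sub_zero, pow_zero, mul_one,
      Nat.cast_zero, zero_mul, zero_add, Nat.cast_one, one_mul]
    rw [mul_add, mul_sum, mul_sum, add_sub_assoc, ← sum_sub_distrib]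
    congr 1
    · ring
    refine sum_congr rfl fun x _ => ?_
    rcases le_or_gt (x.2 + 1) x.1 with h | h
    · obtain ⟨d, hd⟩ := Nat.exists_eq_add_of_le h
      rw [show x.1 - x.2 = d + 1 by omega, show x.1 - (x.2 + 1) = d by omega]
      ring
    · rw [lucasTriangle_eq_zero h]
      push_cast
      ring

end Ring

/-- Waring's formula for power sums of two numbers, with the sign of the argument reversed. -/
theorem neg_one_pow_mul_dicksonValue (a r : ℂ) {n : ℕ} (hn : 0 < n) :
    (-1) ^ n * dicksonValue a r n = ∑ i ∈ range (n / 2 + 1),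
      (-1 : ℂ) ^ (n - i) * ((n : ℂ) / ((n : ℂ) - (i : ℂ))) * ((n - i).choose i : ℂ) * a ^ i *
        r ^ (n - 2 * i) := by
  rw [dicksonValue_eq_sum_antidiagonal, ← Nat.sum_antidiagonal_swap,
    Nat.sum_antidiagonal_eq_sum_range_succ_mk, mul_sum]
  simp only [Prod.fst_swap, Prod.snd_swap]
  symm
  apply sum_subset_zero_on_sdiff
  · intro i; simp only [mem_range]; omega
  · intro i hi
    simp only [mem_sdiff, mem_range] at hi
    rw [lucasTriangle_eq_zero (by omega)]
    simp
  · intro i hi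
    have hi' : i < n / 2 + 1 := mem_range.1 hi
    have hne : ((n - i : ℕ) : ℂ) ≠ 0 := by
      rw [Nat.cast_ne_zero]; omega
    have h := congrArg (Nat.cast (R := ℂ)) (mul_lucasTriangle (n - i) i)
    rw [Nat.sub_add_cancel (by omega)] at h
    push_cast at h
    have hsgn : (-1 : ℂ) ^ (n - i) = (-1) ^ n * (-1) ^ i := by
      conv_rhs => rw [← Nat.sub_add_cancel (show i ≤ n by omega), pow_add, mul_assoc, ← pow_add,
        ← two_mul, pow_mul]
      simp
    have h2 : (n : ℂ) / ((n : ℂ) - i) * (n - i).choose i = lucasTriangle (n - i) i := by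
      rw [← Nat.cast_sub (by omega), div_mul_eq_mul_div, div_eq_iff hne, ← h, mul_comm]
    rw [show n - i - i = n - 2 * i by omega, neg_pow a, hsgn]
    linear_combination ((-1) ^ n * (-1) ^ i * a ^ i * r ^ (n - 2 * i)) * h2

theorem ofReal_dicksonValue (a r : ℝ) (n : ℕ) :
    ((dicksonValue a r n : ℝ) : ℂ) = dicksonValue (a : ℂ) (r : ℂ) n := by
  induction n using Nat.twoStepInduction with
  | zero => simp [dicksonValue_zero]
  | one => simp [dicksonValue_one]
  | more n h1 h2 =>
    rw [dicksonValue_add_two, dicksonValue_add_two, ← h1, ← h2]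
    push_cast
    ring

section Bounds

variable (a r : ℝ)

/-- The companion sequence `U_n = (u ^ n - v ^ n) / (u - v)` of the Dickson values
`u ^ n + v ^ n`. -/
noncomputable def dicksonCompanion : ℕ → ℝ
  | 0 => 0
  | n + 1 => (r * dicksonCompanion n + dicksonValue a r n) / 2

theorem two_mul_dicksonValue_succ (n : ℕ) : 2 * dicksonValue a r (n + 1) =
    r * dicksonValue a r n + (r ^ 2 - 4 * a) * dicksonCompanion a r n := by
  induction n with
  | zero => simp [dicksonCompanion, dicksonValue_zero, dicksonValue_one, mul_comm]
  | succ n ih =>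
    rw [dicksonValue_add_two, dicksonCompanion]
    linear_combination r / 2 * ih

theorem two_mul_dicksonValue_add (m n : ℕ) :
    2 * dicksonValue a r (m + n) = dicksonValue a r m * dicksonValue a r n +
        (r ^ 2 - 4 * a) * dicksonCompanion a r m * dicksonCompanion a r n ∧
      2 * dicksonCompanion a r (m + n) = dicksonCompanion a r m * dicksonValue a r n +
        dicksonValue a r m * dicksonCompanion a r n := by
  induction n with
  | zero =>
    simp only [add_zero, dicksonValue_zero, dicksonCompanion]
    constructor <;> ring
  | succ n ih =>
    obtain ⟨h1, h2⟩ := ih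
    have h3 := two_mul_dicksonValue_succ a r (m + n)
    have h4 := two_mul_dicksonValue_succ a r n
    rw [← add_assoc]
    constructor
    · rw [dicksonCompanion]
      linear_combination h3 + r / 2 * h1 + (r ^ 2 - 4 * a) / 2 * h2 - dicksonValue a r m / 2 * h4
    · rw [dicksonCompanion, dicksonCompanion]
      linear_combination r / 2 * h2 + 1 / 2 * h1 - dicksonCompanion a r m / 2 * h4

/-- The norm identity `D_n ^ 2 - (r ^ 2 - 4 a) U_n ^ 2 = 4 a ^ n`. -/
theorem dicksonValue_sq (n : ℕ) : dicksonValue a r n ^ 2 =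
    4 * a ^ n + (r ^ 2 - 4 * a) * dicksonCompanion a r n ^ 2 := by
  induction n with
  | zero => norm_num [dicksonValue_zero, dicksonCompanion]
  | succ n ih =>
    have h := two_mul_dicksonValue_succ a r n
    have h' : dicksonValue a r (n + 1) = (r * dicksonValue a r n +
      (r ^ 2 - 4 * a) * dicksonCompanion a r n) / 2 := by linarith
    rw [h', dicksonCompanion, pow_succ a]
    linear_combination a * ih

variable {a r}

theorem dicksonValue_sq_le (h : r ^ 2 ≤ 4 * a) (n : ℕ) : dicksonValue a r n ^ 2 ≤ 4 * a ^ n := by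
  rw [dicksonValue_sq]
  nlinarith [sq_nonneg (dicksonCompanion a r n)]

/-- In even degree no bound on the argument is needed, by `D_{2s} = D_s ^ 2 - 2 a ^ s`. -/
theorem neg_two_mul_pow_le_dicksonValue (s : ℕ) : -(2 * a ^ s) ≤ dicksonValue a r (2 * s) := by
  have h1 := (two_mul_dicksonValue_add a r s s).1
  have h2 := dicksonValue_sq a r s
  rw [two_mul s]
  nlinarith [sq_nonneg (dicksonValue a r s)]

/-- If the roots of `X ^ 2 - r X + a` are real and nonnegative, then `u ^ n + v ^ n ≤ (u + v) ^ n`. -/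
theorem dicksonValue_nonneg_and_le (hr : 0 ≤ r) (ha : 0 ≤ a) (h : 4 * a ≤ r ^ 2) (n : ℕ) :
    0 ≤ dicksonValue a r (n + 1) ∧ dicksonValue a r (n + 1) ≤ r ^ (n + 1) := by
  have hpos : ∀ n, 0 ≤ dicksonValue a r n ∧ 0 ≤ dicksonCompanion a r n := by
    intro n
    induction n with
    | zero => norm_num [dicksonValue_zero, dicksonCompanion]
    | succ n ih =>
      have h1 := two_mul_dicksonValue_succ a r n
      have h2 := mul_nonneg hr ih.1
      have h3 := mul_nonneg (sub_nonneg.2 h) ih.2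
      have h4 := mul_nonneg hr ih.2
      refine ⟨by linarith, ?_⟩
      rw [dicksonCompanion]
      linarith [ih.1]
  refine ⟨(hpos _).1, ?_⟩
  induction n with
  | zero => simp [dicksonValue_one]
  | succ n ih =>
    rw [dicksonValue_add_two, pow_succ']
    have := mul_le_mul_of_nonneg_left ih hr
    have := mul_nonneg ha (hpos n).1
    linarith

/-- Either `|r| ≤ 2√a` and the Dickson values are oscillating, or the recurrence is dominated by
its first term. -/
theorem dicksonValue_odd_le (ha : 1 ≤ a) (s : ℕ) :
    dicksonValue a r (2 * s + 1) ≤ 2 * a ^ (s + 1) + |r| ^ (2 * s + 1) := by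
  have ha0 : 0 ≤ a := zero_le_one.trans ha
  have h1 : 0 ≤ 2 * a ^ (s + 1) := by positivity
  have h2 : 0 ≤ |r| ^ (2 * s + 1) := by positivity
  rcases le_total (r ^ 2) (4 * a) with h | h
  · have h3 := dicksonValue_sq_le h (2 * s + 1)
    have h4 : 4 * a ^ (2 * s + 1) ≤ (2 * a ^ (s + 1)) ^ 2 := by
      have : a ^ (2 * s + 1) ≤ a ^ (2 * s + 2) := pow_le_pow_right₀ ha (by omega)
      calc 4 * a ^ (2 * s + 1) ≤ 4 * a ^ (2 * s + 2) := by linarith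
        _ = _ := by ring
    have := abs_le_of_sq_le_sq (h3.trans h4) h1
    linarith [(abs_le.1 this).2]
  · rcases le_total 0 r with hr | hr
    · have := (dicksonValue_nonneg_and_le hr ha0 h (2 * s)).2
      rw [abs_of_nonneg hr]
      linarith
    · have h5 := (dicksonValue_nonneg_and_le (r := -r) (by linarith) ha0 (by simpa using h)
        (2 * s)).1
      rw [dicksonValue_neg, Odd.neg_one_pow ⟨s, rfl⟩] at h5
      linarith

end Bounds

end Dickson

/-! ### The lifting relation and the norm-one group -/

section Lift

variable {k : Type*} [Field k] [Fintype k] [DecidableEq k]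

theorem primePowerSum_recurrence (ψ : AddChar k ℂ) (hψ : ψ.IsPrimitive) (n : ℕ) :
    primePowerSum (kloostermanWeight ψ) (n + 1) = (-1) ^ n * dicksonValue (Fintype.card k : ℂ)
      (∑ x : kˣ, ψ ((x : k) + (x : k)⁻¹)) (n + 1) := by
  have hψ0 : ψ ≠ 0 := by
    rintro rfl
    exact hψ one_ne_zero (by ext; simp)
  have main := mul_sum_monicOfDegree (kloostermanWeight ψ) (kloostermanWeight_one ψ)
    (kloostermanWeight_mul ψ)
  have h0 := sum_kloostermanWeight_zero ψ
  have h1 := sum_kloostermanWeight_one ψ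
  have h2 := sum_kloostermanWeight_two ψ hψ
  set K := ∑ x : kˣ, ψ ((x : k) + (x : k)⁻¹)
  have e1 : primePowerSum (kloostermanWeight ψ) 1 = K := by
    have := main 1
    simpa [h0, h1] using this.symm
  have e2 : primePowerSum (kloostermanWeight ψ) 2 = 2 * Fintype.card k - K ^ 2 := by
    have := main 2
    rw [show Icc 1 2 = {1, 2} from rfl, sum_pair (by norm_num)] at this
    norm_num [h0, h1, h2, e1] at this
    linear_combination -this
  have e3 : ∀ n : ℕ, primePowerSum (kloostermanWeight ψ) (n + 3) =
      -(K * primePowerSum (kloostermanWeight ψ) (n + 2)) -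
        Fintype.card k * primePowerSum (kloostermanWeight ψ) (n + 1) := by
    intro n
    have := main (n + 3)
    rw [sum_kloostermanWeight_eq_zero ψ hψ0 (by omega), mul_zero] at this
    rw [← sum_subset (s₁ := {n + 1, n + 2, n + 3})] at this
    · rw [sum_insert (by simp), sum_pair (by simp)] at this
      rw [show n + 3 - (n + 1) = 2 by omega, show n + 3 - (n + 2) = 1 by omega, Nat.sub_self,
        h0, h1, h2] at this
      linear_combination -this
    · intro j hj
      simp only [mem_insert, mem_singleton] at hj
      rw [mem_Icc]
      omega
    · intro j hj hj'
      simp only [mem_insert, mem_singleton] at hj'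
      rw [mem_Icc] at hj
      rw [sum_kloostermanWeight_eq_zero ψ hψ0 (by omega), mul_zero]
  induction n using Nat.twoStepInduction with
  | zero => simp [e1, dicksonValue_one]
  | one =>
    rw [show 1 + 1 = 0 + 2 from rfl, dicksonValue_add_two, zero_add, e2, zero_add,
      dicksonValue_one, dicksonValue_zero]
    ring
  | more n ih1 ih2 =>
    rw [e3, ih1, ih2, dicksonValue_add_two (n := n + 1)]
    ring

variable {E : Type*} [Field E] [Fintype E] [DecidableEq E] [Algebra k E]

/-- The Kloosterman analogue of the Hasse–Davenport relation: up to sign, the sum over the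
extension of degree `n` is the `n`-th power sum of the two reciprocal roots of the `L`-function
over the base field. -/
theorem sum_addChar_trace_add_inv (ψ : AddChar k ℂ) (hψ : ψ.IsPrimitive) :
    ∑ x : Eˣ, ψ (Algebra.trace k E ((x : E) + (x : E)⁻¹)) =
      -((-1) ^ Module.finrank k E * dicksonValue (Fintype.card k : ℂ)
        (∑ x : kˣ, ψ ((x : k) + (x : k)⁻¹)) (Module.finrank k E)) := by
  have h := primePowerSum_eq_sum (E := E) (kloostermanWeight ψ)
  obtain ⟨n, hn⟩ : ∃ n, Module.finrank k E = n + 1 :=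
    ⟨Module.finrank k E - 1, by have := Module.finrank_pos (R := k) (M := E); omega⟩
  have h2 : ∑ x : Eˣ, ψ (Algebra.trace k E ((x : E) + (x : E)⁻¹)) =
      primePowerSum (kloostermanWeight ψ) (Module.finrank k E) := by
    rw [h, sum_congr rfl fun x _ => kloostermanWeight_minpoly_pow ψ x]
    rw [← sum_subset (subset_univ (univ.filter fun x : E => x ≠ 0))]
    · refine sum_bij (fun x _ => (x : E)) (fun x _ => by simp) (fun x _ y _ h => Units.ext h) ?_ ?_
      · intro b hb
        exact ⟨Units.mk0 b (mem_filter.1 hb).2, mem_univ _, rfl⟩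
      · intro x _
        rw [if_neg x.ne_zero]
    · intro x _ hx
      rw [if_pos (by simpa using hx)]
  rw [h2, hn, primePowerSum_recurrence ψ hψ]
  ring

end Lift

section Circle

variable {E F : Type*} [Field E] [Fintype E] [Field F] [Fintype F] [DecidableEq F] [Algebra E F]

variable (E F) in
/-- The elements of relative norm one in the quadratic extension `F / E` of finite fields. -/
def normOne : Finset F := univ.filter fun u => u ^ (Fintype.card E + 1) = 1

omit [Field E] [Algebra E F] in
theorem mem_normOne {u : F} : u ∈ normOne E F ↔ u ^ (Fintype.card E + 1) = 1 := by
  simp [normOne]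

omit [Algebra E F] in
theorem ne_zero_of_mem_normOne {u : F} (hu : u ∈ normOne E F) : u ≠ 0 := by
  rintro rfl
  simp [mem_normOne] at hu

omit [Field E] [Algebra E F] in
theorem pow_card_of_mem_normOne {u : F} (hu : u ∈ normOne E F) :
    u ^ Fintype.card E = u⁻¹ := by
  rw [mem_normOne, pow_succ] at hu
  exact eq_inv_of_mul_eq_one_left hu

omit [DecidableEq F] in
theorem algebraMap_trace_eq_add_pow (h2 : Module.finrank E F = 2) (x : F) :
    algebraMap E F (Algebra.trace E F x) = x + x ^ Fintype.card E := by
  rw [FiniteField.algebraMap_trace_eq_sum_pow, h2, Nat.card_eq_fintype_card]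
  simp [sum_range_succ]

theorem algebraMap_trace_of_mem_normOne (h2 : Module.finrank E F = 2) {u : F}
    (hu : u ∈ normOne E F) : algebraMap E F (Algebra.trace E F u) = u + u⁻¹ := by
  rw [algebraMap_trace_eq_add_pow h2, pow_card_of_mem_normOne hu]

theorem eq_or_eq_inv_of_add_inv_eq {K : Type*} [Field K] {x y : K} (hx : x ≠ 0) (hy : y ≠ 0)
    (h : x + x⁻¹ = y + y⁻¹) : x = y ∨ x = y⁻¹ := by
  have h1 : (x - y) * (x * y - 1) = 0 := by
    field_simp at h
    linear_combination h
  rcases mul_eq_zero.1 h1 with h2 | h2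
  · exact Or.inl (sub_eq_zero.1 h2)
  · exact Or.inr (eq_inv_of_mul_eq_one_left (sub_eq_zero.1 h2))

theorem exists_algebraMap_eq_of_pow_card_eq {x : F} (hx : x ^ Fintype.card E = x) :
    ∃ v : E, algebraMap E F v = x := by
  have hcard : 1 < Fintype.card E := Fintype.one_lt_card
  have hne : (X ^ Fintype.card E - X : F[X]) ≠ 0 := FiniteField.X_pow_card_sub_X_ne_zero F hcard
  have hsub : univ.image (algebraMap E F) ⊆ univ.filter fun y : F => y ^ Fintype.card E = y := by
    intro y hy
    obtain ⟨v, -, rfl⟩ := mem_image.1 hy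
    rw [mem_filter, ← map_pow, FiniteField.pow_card]
    exact ⟨mem_univ _, rfl⟩
  have hle : #(univ.filter fun y : F => y ^ Fintype.card E = y) ≤ Fintype.card E := by
    have := card_le_degree_of_subset_roots (p := (X ^ Fintype.card E - X : F[X]))
      (Z := univ.filter fun y : F => y ^ Fintype.card E = y) (by
        intro y hy
        rw [mem_roots hne]
        simpa [sub_eq_zero] using hy)
    rwa [FiniteField.X_pow_card_sub_X_natDegree_eq F hcard] at this
  have heq := eq_of_subset_of_card_le hsub (by
    rwa [card_image_of_injective _ (algebraMap E F).injective, card_univ])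
  obtain ⟨v, -, hv⟩ := mem_image.1 (heq ▸ mem_filter.2 ⟨mem_univ x, hx⟩ :
    x ∈ univ.image (algebraMap E F))
  exact ⟨v, hv⟩

omit [DecidableEq F] in
theorem exists_add_inv_eq (h2 : Module.finrank E F = 2) (c : E) :
    ∃ r : F, r ≠ 0 ∧ r + r⁻¹ = algebraMap E F c := by
  classical
  set f : E[X] := X ^ 2 - C c * X + 1 with hf
  have hfm : f.Monic := by rw [hf]; monicity!
  have hfd : f.natDegree = 2 := by rw [hf]; compute_degree!
  obtain ⟨r, hr⟩ : ∃ r : F, aeval r f = 0 := by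
    by_cases hi : Irreducible f
    · have := card_filter_minpoly_eq (E := F) hfm hi (by rw [hfd, h2])
      rw [hfd] at this
      obtain ⟨x, hx⟩ := card_pos.1 (by rw [this]; norm_num)
      refine ⟨x, ?_⟩
      rw [← (mem_filter.1 hx).2]
      exact minpoly.aeval _ _
    · rw [hfm.irreducible_iff_roots_eq_zero_of_degree_le_three (by omega) (by omega)] at hi
      obtain ⟨x, hx⟩ := Multiset.exists_mem_of_ne_zero hi
      refine ⟨algebraMap E F x, ?_⟩
      rw [aeval_algebraMap_apply, coe_aeval_eq_eval, (mem_roots'.1 hx).2.eq_zero, map_zero]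
  have hr' : r ^ 2 - algebraMap E F c * r + 1 = 0 := by simpa [hf] using hr
  have hr0 : r ≠ 0 := by
    rintro rfl
    simp at hr'
  refine ⟨r, hr0, ?_⟩
  field_simp
  linear_combination hr'

/-- Every `c : E` is `v + v⁻¹` exactly twice, with `v` a unit of `E` or of norm one in `F`; the
solutions `1` and `-1` count on both sides. -/
theorem card_units_add_card_normOne [DecidableEq E] (h2 : Module.finrank E F = 2) (c : E) :
    #{v : Eˣ | (v : E) + (v : E)⁻¹ = c} + #{u ∈ normOne E F | Algebra.trace E F u = c} = 2 := by
  obtain ⟨r, hr0, hr⟩ := exists_add_inv_eq (F := F) h2 c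
  have hinj := (algebraMap E F).injective
  have hB : ∀ u, u ∈ normOne E F → (Algebra.trace E F u = c ↔ u = r ∨ u = r⁻¹) := by
    intro u hu
    rw [← hinj.eq_iff, algebraMap_trace_of_mem_normOne h2 hu, ← hr]
    refine ⟨eq_or_eq_inv_of_add_inv_eq (ne_zero_of_mem_normOne hu) hr0, ?_⟩
    rintro (rfl | rfl)
    · rfl
    · rw [inv_inv, add_comm]
  have hA : ∀ v : Eˣ, (v : E) + (v : E)⁻¹ = c ↔
      algebraMap E F v = r ∨ algebraMap E F v = r⁻¹ := by
    intro v
    rw [← hinj.eq_iff, map_add, map_inv₀, ← hr]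
    refine ⟨eq_or_eq_inv_of_add_inv_eq (by simp) hr0, ?_⟩
    rintro (h | h)
    · rw [h]
    · rw [h, inv_inv, add_comm]
  -- `r ^ |E|` is again a solution, so it is `r` (then `r ∈ E`) or `r⁻¹` (then `r` has norm one)
  have hconj : r ^ Fintype.card E = r ∨ r ^ Fintype.card E = r⁻¹ := by
    apply eq_or_eq_inv_of_add_inv_eq (pow_ne_zero _ hr0) hr0
    have h := congrArg (· ^ Fintype.card E) hr
    simp only [← map_pow, FiniteField.pow_card] at h
    have h' := map_add (FiniteField.frobeniusAlgHom E F) r r⁻¹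
    simp only [FiniteField.coe_frobeniusAlgHom] at h'
    rw [← inv_pow, ← h', h, hr]
  have hE : ∀ v : E, algebraMap E F v ^ Fintype.card E = algebraMap E F v := by
    intro v
    rw [← map_pow, FiniteField.pow_card]
  by_cases hrE : r ^ Fintype.card E = r
  · obtain ⟨v, rfl⟩ := exists_algebraMap_eq_of_pow_card_eq hrE
    have hv0 : v ≠ 0 := by rintro rfl; simp at hr0
    obtain ⟨w, rfl⟩ : ∃ w : Eˣ, (w : E) = v := ⟨Units.mk0 v hv0, rfl⟩
    have h1 : (univ.filter fun v : Eˣ => (v : E) + (v : E)⁻¹ = c) = {w, w⁻¹} := by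
      ext v
      rw [mem_filter, hA, ← map_inv₀, hinj.eq_iff, hinj.eq_iff, ← Units.val_inv_eq_inv_val,
        Units.val_inj, Units.val_inj]
      simp
    rw [h1]
    by_cases hw : w = w⁻¹
    · have hw' : (w : E) = (w : E)⁻¹ := by rw [← Units.val_inv_eq_inv_val, ← hw]
      have h3 : (normOne E F).filter (fun u => Algebra.trace E F u = c) =
          {algebraMap E F w} := by
        ext u
        rw [mem_filter, mem_singleton]
        constructor
        · rintro ⟨h4, h5⟩
          rw [hB u h4, ← map_inv₀, ← hw', or_self] at h5
          exact h5
        · rintro rfl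
          have h4 : algebraMap E F w ∈ normOne E F := by
            rw [mem_normOne, pow_succ, hE, ← map_mul]
            nth_rewrite 2 [hw']
            rw [mul_inv_cancel₀ hv0, map_one]
          exact ⟨h4, (hB _ h4).2 (Or.inl rfl)⟩
      rw [h3, ← hw]
      simp
    · have h3 : (normOne E F).filter (fun u => Algebra.trace E F u = c) = ∅ := by
        rw [filter_eq_empty_iff]
        intro u hu h4
        have h5 := pow_card_of_mem_normOne hu
        apply hw
        rcases (hB u hu).1 h4 with rfl | rfl
        · rw [hE, ← map_inv₀, hinj.eq_iff, ← Units.val_inv_eq_inv_val, Units.val_inj] at h5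
          exact h5
        · rw [← map_inv₀, hE, ← map_inv₀, hinj.eq_iff, inv_inv, ← Units.val_inv_eq_inv_val,
            Units.val_inj] at h5
          exact h5.symm
      rw [h3, card_pair hw, card_empty]
  · have hrI := hconj.resolve_left hrE
    have hne : r ≠ r⁻¹ := fun h => hrE (by rw [hrI, ← h])
    have h1 : (univ.filter fun v : Eˣ => (v : E) + (v : E)⁻¹ = c) = ∅ := by
      rw [filter_eq_empty_iff]
      intro v _ hv
      have h3 := hE v
      rcases (hA v).1 hv with h4 | h4
      · rw [h4] at h3
        exact hrE h3
      · rw [h4, inv_pow, hrI, inv_inv] at h3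
        exact hne h3
    have h3 : (normOne E F).filter (fun u => Algebra.trace E F u = c) = {r, r⁻¹} := by
      have hr1 : r ∈ normOne E F := by
        rw [mem_normOne, pow_succ, hrI, inv_mul_cancel₀ hr0]
      have hr2 : r⁻¹ ∈ normOne E F := by
        rw [mem_normOne] at hr1 ⊢
        rw [inv_pow, hr1, inv_one]
      ext u
      rw [mem_filter, mem_insert, mem_singleton]
      constructor
      · rintro ⟨h4, h5⟩
        exact (hB u h4).1 h5
      · rintro (rfl | rfl)
        · exact ⟨hr1, (hB _ hr1).2 (Or.inl rfl)⟩
        · exact ⟨hr2, (hB _ hr2).2 (Or.inr rfl)⟩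
    rw [h1, h3, card_pair hne, card_empty]

/-- Sums over the units of `E` and over the elements of norm one complement each other. -/
theorem sum_units_add_sum_normOne [DecidableEq E] {M : Type*} [AddCommMonoid M]
    (h2 : Module.finrank E F = 2) (g : E → M) :
    ∑ v : Eˣ, g ((v : E) + (v : E)⁻¹) + ∑ u ∈ normOne E F, g (Algebra.trace E F u) =
      2 • ∑ c : E, g c := by
  rw [← sum_fiberwise_of_maps_to (s := univ) (t := univ) (g := fun v : Eˣ => (v : E) + (v : E)⁻¹)
      (fun _ _ => mem_univ _),
    ← sum_fiberwise_of_maps_to (s := normOne E F) (t := univ) (g := fun u => Algebra.trace E F u)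
      (fun _ _ => mem_univ _), ← sum_add_distrib, smul_sum]
  refine sum_congr rfl fun c _ => ?_
  rw [sum_congr rfl (g := fun _ => g c) fun v hv => by rw [(mem_filter.1 hv).2],
    sum_congr rfl (g := fun _ => g c) (s₁ := (normOne E F).filter _)
      fun v hv => by rw [(mem_filter.1 hv).2],
    sum_const, sum_const, ← add_nsmul, card_units_add_card_normOne h2]

theorem card_normOne (h2 : Module.finrank E F = 2) :
    #(normOne E F) = Fintype.card E + 1 := by
  classical
  have h := sum_units_add_sum_normOne h2 (fun _ => (1 : ℕ))
  simp only [sum_const, card_univ, smul_eq_mul, mul_one] at h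
  have h3 := Fintype.card_units (α := E)
  have h4 : 1 < Fintype.card E := Fintype.one_lt_card
  omega

/-- Every element of norm one is a `(|E| - 1)`-st power in exactly `|E| - 1` ways. -/
theorem sum_pow_card_sub_one (h2 : Module.finrank E F = 2) {M : Type*} [AddCommMonoid M]
    (g : F → M) : ∑ y : Fˣ, g ((y : F) ^ (Fintype.card E - 1)) =
      (Fintype.card E - 1) • ∑ u ∈ normOne E F, g u := by
  have hQ : 1 < Fintype.card E := Fintype.one_lt_card
  have hF : Fintype.card F - 1 = (Fintype.card E - 1) * (Fintype.card E + 1) := by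
    rw [Module.card_eq_pow_finrank (K := E) (V := F), h2, mul_comm, ← Nat.sq_sub_sq, one_pow]
  have hmaps : ∀ y ∈ (univ : Finset Fˣ), (y : F) ^ (Fintype.card E - 1) ∈ normOne E F := by
    intro y _
    rw [mem_normOne, ← pow_mul, ← hF, FiniteField.pow_card_sub_one_eq_one _ y.ne_zero]
  -- every fibre has at most `|E| - 1` elements, and the sizes of `Fˣ` and `normOne` force equality
  have hle : ∀ u ∈ normOne E F, #{y : Fˣ | (y : F) ^ (Fintype.card E - 1) = u} ≤
      Fintype.card E - 1 := by
    intro u _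
    refine le_trans ?_ (card_nthRoots (Fintype.card E - 1) u)
    refine le_trans ?_ (Multiset.toFinset_card_le _)
    refine card_le_card_of_injOn (fun y => (y : F)) ?_ (fun x _ y _ h => Units.ext h)
    intro y hy
    have := (mem_filter.1 hy).2
    simpa [mem_nthRoots (show 0 < Fintype.card E - 1 by omega)] using this
  have hsum : ∑ u ∈ normOne E F, #{y : Fˣ | (y : F) ^ (Fintype.card E - 1) = u} =
      ∑ u ∈ normOne E F, (Fintype.card E - 1) := by
    rw [← card_eq_sum_card_fiberwise hmaps, sum_const, card_normOne h2, card_univ,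
      Fintype.card_units, hF, smul_eq_mul, mul_comm]
  have heq := (sum_eq_sum_iff_of_le hle).1 hsum
  rw [← sum_fiberwise_of_maps_to hmaps, smul_sum]
  refine sum_congr rfl fun u hu => ?_
  rw [sum_congr rfl (g := fun _ => g u) fun v hv => by rw [(mem_filter.1 hv).2], sum_const,
    heq u hu]

end Circle

/-! ### Character sums and traces on the norm-one group -/

section CircleSum

variable {k E F : Type*} [Field k] [Fintype k] [DecidableEq k] [Field E] [Fintype E]
  [DecidableEq E] [Field F] [Fintype F] [DecidableEq F] [Algebra k E] [Algebra E F] [Algebra k F]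
  [IsScalarTower k E F]

/-- The character sum over the norm-one group is the negative of the Kloosterman sum over `E`,
hence a Dickson value of the Kloosterman sum over the base field. -/
theorem sum_normOne_addChar (h2 : Module.finrank E F = 2) (ψ : AddChar k ℂ)
    (hψ : ψ.IsPrimitive) :
    ∑ u ∈ normOne E F, ψ (Algebra.trace k F u) =
      (-1) ^ Module.finrank k E * dicksonValue (Fintype.card k : ℂ)
        (∑ x : kˣ, ψ ((x : k) + (x : k)⁻¹)) (Module.finrank k E) := by
  have h := sum_units_add_sum_normOne (F := F) h2 (fun c => ψ (Algebra.trace k E c))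
  rw [sum_addChar_trace_add_inv ψ hψ] at h
  simp only [Algebra.trace_trace] at h
  have h0 : ∑ c : E, ψ (Algebra.trace k E c) = 0 := by
    have := AddChar.sum_eq_zero_iff_ne_zero (ψ := ψ.compAddMonoidHom
      (Algebra.trace k E).toAddMonoidHom)
    simp only [AddChar.compAddMonoidHom_apply, LinearMap.toAddMonoidHom_coe] at this
    rw [this, AddChar.ne_zero_iff]
    have hne : ψ ≠ 0 := by
      rintro rfl
      exact hψ one_ne_zero (by ext; simp)
    obtain ⟨a, ha⟩ := AddChar.ne_zero_iff.1 hne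
    obtain ⟨b, rfl⟩ := Algebra.trace_surjective k E a
    exact ⟨b, ha⟩
  rw [h0, smul_zero] at h
  linear_combination h

omit [DecidableEq E] in
theorem exists_pow_card_sub_one_eq (h2 : Module.finrank E F = 2) {u : F}
    (hu : u ∈ normOne E F) : ∃ y : Fˣ, (y : F) ^ (Fintype.card E - 1) = u := by
  -- the sum of the indicator function of `u` over all powers would vanish
  by_contra! h
  have h1 := sum_pow_card_sub_one h2 (fun v => if v = u then 1 else 0)
  rw [sum_eq_zero fun y _ => if_neg (h y)] at h1
  have h3 : 1 < Fintype.card E := Fintype.one_lt_card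
  simp [hu] at h1
  omega

omit [DecidableEq E] in
theorem mem_zpowers_pow_card_sub_one (h2 : Module.finrank E F = 2) {α : Fˣ}
    (hα : ∀ x : Fˣ, x ∈ Subgroup.zpowers α) (x : Fˣ) :
    x ∈ Subgroup.zpowers (α ^ (Fintype.card E - 1)) ↔ (x : F) ∈ normOne E F := by
  have hQ : 1 < Fintype.card E := Fintype.one_lt_card
  constructor
  · rw [Subgroup.mem_zpowers_iff]
    rintro ⟨j, rfl⟩
    have h : (α ^ (Fintype.card E - 1)) ^ (Fintype.card E + 1) = 1 := by
      rw [← pow_mul, mul_comm, ← Nat.sq_sub_sq, one_pow, ← h2,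
        ← Module.card_eq_pow_finrank (K := E) (V := F), ← Fintype.card_units, pow_card_eq_one]
    rw [mem_normOne, ← Units.val_pow_eq_pow_val, ← zpow_natCast, zpow_comm, zpow_natCast, h,
      one_zpow, Units.val_one]
  · intro hx
    obtain ⟨y, hy⟩ := exists_pow_card_sub_one_eq h2 hx
    obtain ⟨j, rfl⟩ := Subgroup.mem_zpowers_iff.1 (hα y)
    refine Subgroup.mem_zpowers_iff.2 ⟨j, Units.ext ?_⟩
    rw [← hy, ← Units.val_pow_eq_pow_val, ← zpow_natCast, ← zpow_natCast, zpow_comm]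

omit [DecidableEq E] in
theorem finsum_zpowers_eq_sum_normOne (h2 : Module.finrank E F = 2) {α : Fˣ}
    (hα : ∀ x : Fˣ, x ∈ Subgroup.zpowers α) (g : F → ℂ) :
    ∑ᶠ x : Subgroup.zpowers (α ^ (Fintype.card E - 1)), g ((x : Fˣ) : F) =
      ∑ u ∈ normOne E F, g u := by
  classical
  rw [finsum_eq_sum_of_fintype]
  refine sum_bij (fun x _ => ((x : Fˣ) : F)) ?_ ?_ ?_ ?_
  · intro x _
    exact (mem_zpowers_pow_card_sub_one h2 hα x).1 x.2
  · intro x _ y _ h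
    exact Subtype.ext (Units.ext h)
  · intro u hu
    have := (mem_zpowers_pow_card_sub_one h2 hα (Units.mk0 u (ne_zero_of_mem_normOne hu))).2 hu
    exact ⟨⟨_, this⟩, mem_univ _, rfl⟩
  · intro _ _; rfl

variable (k E F) in
/-- The number of elements of relative norm one in `F / E` whose trace to `k` vanishes. -/
noncomputable def traceZeroCount : ℕ := #{u ∈ normOne E F | Algebra.trace k F u = 0}

omit [Fintype k] in
/-- As the elements `u` and `u⁻¹` are the only ones with a given trace to `E`, at most two elements
of norm one lie above each element of the kernel of the trace `E → k`. -/
theorem traceZeroCount_le (h2 : Module.finrank E F = 2) :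
    traceZeroCount k E F ≤ 2 * #{c : E | Algebra.trace k E c = 0} := by
  rw [traceZeroCount, mul_comm]
  have hmaps : ∀ u ∈ (normOne E F).filter (fun u => Algebra.trace k F u = 0),
      Algebra.trace E F u ∈ univ.filter fun c : E => Algebra.trace k E c = 0 := by
    intro u hu
    rw [mem_filter, Algebra.trace_trace]
    exact ⟨mem_univ _, (mem_filter.1 hu).2⟩
  rw [card_eq_sum_card_fiberwise hmaps, mul_comm]
  refine (sum_le_card_nsmul _ _ 2 ?_).trans (by rw [smul_eq_mul, mul_comm])
  intro c _
  refine le_trans ?_ ((Nat.le_add_left _ _).trans (card_units_add_card_normOne (F := F) h2 c).le)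
  exact card_le_card (filter_subset_filter _ (filter_subset _ _))

omit [Fintype k] [DecidableEq E] [Algebra k E] [Algebra E F] [IsScalarTower k E F] in
theorem even_traceZeroCount (h2 : (2 : F) ≠ 0) (hodd : Odd (Fintype.card E)) :
    Even (traceZeroCount k E F) := by
  rw [traceZeroCount, ← ZMod.natCast_eq_zero_iff_even, card_eq_sum_ones, Nat.cast_sum]
  refine sum_involution (fun u _ => -u) ?_ ?_ ?_ ?_
  · intro u _
    decide
  · intro u hu _ h
    have h3 : (2 : F) * u = 0 := by linear_combination -h
    exact ne_zero_of_mem_normOne (mem_filter.1 hu).1 ((mul_eq_zero.1 h3).resolve_left h2)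
  · intro u hu
    obtain ⟨h3, h4⟩ := mem_filter.1 hu
    rw [mem_filter, mem_normOne, map_neg, h4, neg_zero, Even.neg_pow hodd.add_one,
      mem_normOne.1 h3]
    exact ⟨rfl, rfl⟩
  · intro u _
    exact neg_neg u

omit [Fintype k] [DecidableEq k] [DecidableEq E] in
theorem trace_inv_of_mem_normOne (h2 : Module.finrank E F = 2) {u : F} (hu : u ∈ normOne E F) :
    Algebra.trace k F u⁻¹ = Algebra.trace k F u := by
  have h3 : u⁻¹ ∈ normOne E F := by
    rw [mem_normOne] at hu ⊢
    rw [inv_pow, hu, inv_one]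
  rw [← Algebra.trace_trace (R := k) (S := E) (T := F) u⁻¹,
    ← Algebra.trace_trace (R := k) (S := E) (T := F) u]
  congr 1
  apply (algebraMap E F).injective
  rw [algebraMap_trace_of_mem_normOne h2 hu, algebraMap_trace_of_mem_normOne h2 h3, inv_inv,
    add_comm]

omit [Fintype k] [DecidableEq E] in
theorem odd_traceZeroCount (h2 : (2 : F) = 0) (hEF : Module.finrank E F = 2) :
    Odd (traceZeroCount k E F) := by
  have h1mem : (1 : F) ∈ (normOne E F).filter (fun u => Algebra.trace k F u = 0) := by
    have h1 : (1 : F) ∈ normOne E F := by rw [mem_normOne, one_pow]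
    refine mem_filter.2 ⟨h1, ?_⟩
    have h3 : Algebra.trace E F 1 = 0 := by
      apply (algebraMap E F).injective
      rw [algebraMap_trace_of_mem_normOne hEF h1, inv_one, map_zero, one_add_one_eq_two, h2]
    rw [← Algebra.trace_trace (S := E) (T := F), h3, map_zero]
  rw [traceZeroCount, ← insert_erase h1mem, card_insert_of_notMem (notMem_erase _ _)]
  refine Even.add_one ?_
  rw [← ZMod.natCast_eq_zero_iff_even, card_eq_sum_ones, Nat.cast_sum]
  refine sum_involution (fun u _ => u⁻¹) ?_ ?_ ?_ ?_
  · intro u _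
    decide
  · intro u hu _ h
    obtain ⟨h3, h4⟩ := mem_erase.1 hu
    have h5 := ne_zero_of_mem_normOne (mem_filter.1 h4).1
    have h6 : u * u = 1 := by
      nth_rewrite 2 [← h]
      exact mul_inv_cancel₀ h5
    have h7 : (u - 1) ^ 2 = 0 := by linear_combination h6 + (1 - u) * h2
    exact h3 (sub_eq_zero.1 (pow_eq_zero_iff two_ne_zero |>.1 h7))
  · intro u hu
    obtain ⟨h3, h4⟩ := mem_erase.1 hu
    obtain ⟨h5, h6⟩ := mem_filter.1 h4
    refine mem_erase.2 ⟨by rwa [Ne, inv_eq_one], mem_filter.2 ⟨?_, by rw [trace_inv_of_mem_normOne hEF h5, h6]⟩⟩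
    rw [mem_normOne] at h5 ⊢
    rw [inv_pow, h5, inv_one]
  · intro u _
    exact inv_inv u

end CircleSum

/-! ### Kloosterman sums over the prime field -/

section PrimeField

variable (p : ℕ) [Fact p.Prime]

/-- The Kloosterman sum `K(z ^ 2)` over the prime field, written symmetrically, as a real
number. -/
noncomputable def realKloosterman (z : (ZMod p)ˣ) : ℝ :=
  (∑ x : (ZMod p)ˣ, ZMod.stdAddChar (N := p) (z * ((x : ZMod p) + (x : ZMod p)⁻¹))).re

variable {p}

theorem ofReal_realKloosterman (z : (ZMod p)ˣ) : (realKloosterman p z : ℂ) =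
    ∑ x : (ZMod p)ˣ, ZMod.stdAddChar (N := p) (z * ((x : ZMod p) + (x : ZMod p)⁻¹)) := by
  rw [realKloosterman]
  refine Complex.conj_eq_iff_re.1 ?_
  rw [map_sum, ← Equiv.sum_comp (Equiv.neg (ZMod p)ˣ)]
  refine sum_congr rfl fun x _ => ?_
  rw [← AddChar.map_neg_eq_conj]
  congr 1
  simp only [Equiv.neg_apply, Units.val_neg, inv_neg]
  ring

theorem kloosterman_sq (z : (ZMod p)ˣ) :
    kloosterman p (ZMod p) ((z : ZMod p) ^ 2) = realKloosterman p z := by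
  rw [ofReal_realKloosterman, kloosterman]
  conv_rhs => rw [← Equiv.sum_comp (Equiv.mulLeft z)]
  refine sum_congr rfl fun x _ => ?_
  simp only [canonicalChar, AddChar.compAddMonoidHom_apply, LinearMap.toAddMonoidHom_coe]
  rw [Algebra.trace_self_apply]
  congr 1
  have hz := z.ne_zero
  have hx := x.ne_zero
  rw [Equiv.coe_mulLeft, Units.val_mul]
  field_simp

theorem sum_units_stdAddChar (c : ZMod p) :
    ∑ z : (ZMod p)ˣ, ZMod.stdAddChar (N := p) (z * c) = (if c = 0 then (p : ℂ) else 0) - 1 := by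
  have h := AddChar.sum_mulShift c (ZMod.isPrimitive_stdAddChar p)
  rw [← add_sum_erase univ _ (mem_univ 0), zero_mul, AddChar.map_zero_eq_one, ZMod.card,
    Nat.cast_ite, Nat.cast_zero] at h
  rw [← h, add_sub_cancel_left]
  refine sum_bij (fun x _ => (x : ZMod p)) (fun x _ => by simp)
    (fun x _ y _ h => Units.ext h) ?_ (fun _ _ => rfl)
  intro b hb
  exact ⟨Units.mk0 b (ne_of_mem_erase hb), mem_univ _, rfl⟩

theorem card_units_zmod : (Fintype.card (ZMod p)ˣ : ℝ) = p - 1 := by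
  rw [ZMod.card_units, Nat.cast_sub (Fact.out : p.Prime).one_le, Nat.cast_one]

theorem abs_realKloosterman_le (z : (ZMod p)ˣ) : |realKloosterman p z| ≤ p - 1 := by
  refine (Complex.abs_re_le_norm _).trans ((norm_sum_le _ _).trans ?_)
  simp only [AddChar.norm_apply, sum_const, card_univ, nsmul_eq_mul, mul_one]
  rw [card_units_zmod]

theorem neg_le_sum_realKloosterman : -((p : ℝ) - 1) ≤ ∑ z : (ZMod p)ˣ, realKloosterman p z := by
  have h : ((∑ z : (ZMod p)ˣ, realKloosterman p z : ℝ) : ℂ) =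
      ((∑ x : (ZMod p)ˣ, ((if (x : ZMod p) + (x : ZMod p)⁻¹ = 0 then (p : ℝ) else 0) - 1) : ℝ)
        : ℂ) := by
    push_cast
    simp only [ofReal_realKloosterman]
    rw [sum_comm]
    refine sum_congr rfl fun x _ => ?_
    rw [sum_units_stdAddChar]
    split_ifs <;> simp
  rw [Complex.ofReal_inj.1 h, sum_sub_distrib, sum_const, card_univ, nsmul_eq_mul,
    card_units_zmod]
  have : 0 ≤ ∑ x : (ZMod p)ˣ, (if (x : ZMod p) + (x : ZMod p)⁻¹ = 0 then (p : ℝ) else 0) :=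
    sum_nonneg fun x _ => by positivity
  linarith

/-- For odd `p`, the equation `x + x⁻¹ + y + y⁻¹ = 0` has at most two solutions `y` for each `x`,
and only one if `x = 1` or `x = -1`. -/
theorem sum_sq_realKloosterman_le (hp : p ≠ 2) :
    ∑ z : (ZMod p)ˣ, realKloosterman p z ^ 2 ≤ (p : ℝ) ^ 2 - 2 * p - 1 := by
  set N : (ZMod p)ˣ → ℕ := fun x => #{y : (ZMod p)ˣ |
    (x : ZMod p) + (x : ZMod p)⁻¹ + ((y : ZMod p) + (y : ZMod p)⁻¹) = 0} with hN
  have h : ((∑ z : (ZMod p)ˣ, realKloosterman p z ^ 2 : ℝ) : ℂ) =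
      ((∑ x : (ZMod p)ˣ, ((p : ℝ) * N x - (p - 1)) : ℝ) : ℂ) := by
    push_cast
    simp only [ofReal_realKloosterman, sq, sum_mul_sum]
    rw [sum_comm]
    refine sum_congr rfl fun x _ => ?_
    rw [sum_comm]
    simp only [← AddChar.map_add_eq_mul, ← mul_add, sum_units_stdAddChar, sum_sub_distrib,
      sum_const, card_univ, nsmul_eq_mul, mul_one]
    rw [← sum_filter, sum_const, nsmul_eq_mul, mul_comm, ZMod.card_units,
      Nat.cast_sub (Fact.out : p.Prime).one_le, Nat.cast_one]
  rw [Complex.ofReal_inj.1 h]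
  have hsub : ∀ x : (ZMod p)ˣ, (univ.filter fun y : (ZMod p)ˣ =>
      (x : ZMod p) + (x : ZMod p)⁻¹ + ((y : ZMod p) + (y : ZMod p)⁻¹) = 0) ⊆ {-x, -x⁻¹} := by
    intro x y hy
    have h1 := (mem_filter.1 hy).2
    rcases eq_or_eq_inv_of_add_inv_eq (x := (y : ZMod p)) (y := ((-x : (ZMod p)ˣ) : ZMod p))
      y.ne_zero (Units.ne_zero _) (by
        rw [Units.val_neg, inv_neg]; linear_combination h1) with h2 | h2
    · rw [Units.val_inj] at h2
      simp [h2]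
    · rw [← Units.val_inv_eq_inv_val, Units.val_inj] at h2
      simp [h2]
  have hle : ∀ x, (N x : ℝ) ≤ 2 - ((if x = 1 then 1 else 0) + if x = -1 then 1 else 0) := by
    intro x
    have h1 := card_le_card (hsub x)
    have hne : (1 : (ZMod p)ˣ) ≠ -1 := by
      intro h
      have h3 : (2 : ZMod p) = 0 := by
        have := congrArg (fun u : (ZMod p)ˣ => (u : ZMod p)) h
        simp only [Units.val_one, Units.val_neg] at this
        linear_combination this
      have h4 : ((2 : ℕ) : ZMod p) = 0 := by exact_mod_cast h3
      rw [ZMod.natCast_eq_zero_iff] at h4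
      exact hp ((Nat.prime_dvd_prime_iff_eq Fact.out Nat.prime_two).1 h4)
    by_cases hx : x = 1
    · subst hx
      rw [if_pos rfl, if_neg hne]
      have : N 1 ≤ 1 := by rwa [inv_one, pair_eq_singleton, card_singleton] at h1
      have : (N 1 : ℝ) ≤ 1 := by exact_mod_cast this
      linarith
    by_cases hx' : x = -1
    · subst hx'
      rw [if_pos rfl, if_neg hne.symm]
      have : N (-1) ≤ 1 := by rwa [inv_neg, inv_one, pair_eq_singleton, card_singleton] at h1
      have : (N (-1) : ℝ) ≤ 1 := by exact_mod_cast this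
      linarith
    · rw [if_neg hx, if_neg hx']
      have : N x ≤ 2 := h1.trans card_le_two
      have : (N x : ℝ) ≤ 2 := by exact_mod_cast this
      linarith
  have hp0 : (0 : ℝ) ≤ p := Nat.cast_nonneg p
  calc ∑ x : (ZMod p)ˣ, ((p : ℝ) * N x - (p - 1))
      ≤ ∑ x : (ZMod p)ˣ, ((p : ℝ) * (2 - ((if x = 1 then 1 else 0) +
          if x = -1 then 1 else 0)) - (p - 1)) :=
        sum_le_sum fun x _ => sub_le_sub_right (mul_le_mul_of_nonneg_left (hle x) hp0) _
    _ = (p : ℝ) ^ 2 - 2 * p - 1 := by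
        rw [sum_sub_distrib, ← mul_sum, sum_sub_distrib, sum_add_distrib, sum_ite_eq', sum_ite_eq',
          if_pos (mem_univ _), if_pos (mem_univ _), sum_const, sum_const, card_univ, nsmul_eq_mul,
          nsmul_eq_mul, card_units_zmod]
        ring

variable {E F : Type*} [Field E] [Fintype E] [DecidableEq E] [Field F] [Fintype F] [DecidableEq F]
  [Algebra (ZMod p) E] [Algebra E F] [Algebra (ZMod p) F] [IsScalarTower (ZMod p) E F]

omit [DecidableEq E] [Algebra (ZMod p) E] [IsScalarTower (ZMod p) E F] in
theorem sum_sum_normOne_stdAddChar (h2 : Module.finrank E F = 2) :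
    ∑ z : (ZMod p)ˣ, ∑ u ∈ normOne E F,
        ZMod.stdAddChar (N := p) (z * Algebra.trace (ZMod p) F u) =
      (p : ℂ) * traceZeroCount (ZMod p) E F - (Fintype.card E + 1) := by
  rw [sum_comm]
  simp only [sum_units_stdAddChar]
  rw [sum_sub_distrib, ← sum_filter, sum_const, sum_const, card_normOne h2, traceZeroCount]
  simp [mul_comm]

theorem sum_normOne_stdAddChar_eq_dicksonValue (h2 : Module.finrank E F = 2) (z : (ZMod p)ˣ) :
    ∑ u ∈ normOne E F, ZMod.stdAddChar (N := p) (z * Algebra.trace (ZMod p) F u) =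
      (-1) ^ Module.finrank (ZMod p) E *
        dicksonValue (p : ℂ) (realKloosterman p z) (Module.finrank (ZMod p) E) := by
  have hprim : ((ZMod.stdAddChar (N := p)).mulShift (z : ZMod p)).IsPrimitive := by
    have : ((ZMod.stdAddChar (N := p)).mulShift (z : ZMod p)) ≠ 1 :=
      ZMod.isPrimitive_stdAddChar p z.ne_zero
    exact AddChar.IsPrimitive.of_ne_one this
  have h := sum_normOne_addChar (E := E) (F := F) h2 _ hprim
  simp only [AddChar.mulShift_apply, ZMod.card] at h
  rw [h, ofReal_realKloosterman]

theorem mul_traceZeroCount (h2 : Module.finrank E F = 2) :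
    (p : ℝ) * traceZeroCount (ZMod p) E F = Fintype.card E + 1 +
      (-1) ^ Module.finrank (ZMod p) E *
        ∑ z : (ZMod p)ˣ, dicksonValue (p : ℝ) (realKloosterman p z) (Module.finrank (ZMod p) E) := by
  have h := sum_sum_normOne_stdAddChar (p := p) (E := E) (F := F) h2
  simp only [sum_normOne_stdAddChar_eq_dicksonValue h2] at h
  rw [← mul_sum] at h
  apply Complex.ofReal_injective
  push_cast
  simp only [ofReal_dicksonValue]
  push_cast
  linear_combination -h

end PrimeField

/-! ### The number of norm-one elements of trace zero -/

section Bounds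

theorem card_filter_eq_mul_card {V W : Type*} [AddCommGroup V] [Fintype V] [AddCommGroup W]
    [Fintype W] [DecidableEq W] (f : V →+ W) (hf : Function.Surjective f) (w : W) :
    #{v | f v = w} * Fintype.card W = Fintype.card V := by
  have h := card_eq_sum_card_fiberwise (s := univ) (t := univ) (f := f) (fun _ _ => mem_univ _)
  rw [card_univ] at h
  rw [h, sum_congr rfl fun x _ => AddMonoidHom.card_fiber_eq_of_mem_range f (hf x) (hf w),
    sum_const, card_univ, smul_eq_mul, mul_comm]

theorem card_filter_trace_eq {p n : ℕ} [Fact p.Prime] {K : Type*} [Field K] [Fintype K]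
    [Algebra (ZMod p) K] (hK : Fintype.card K = p ^ (n + 1)) (s : ZMod p) :
    #{x : K | Algebra.trace (ZMod p) K x = s} = p ^ n := by
  have h := card_filter_eq_mul_card (Algebra.trace (ZMod p) K).toAddMonoidHom
    (Algebra.trace_surjective (ZMod p) K) s
  rw [hK, ZMod.card, pow_succ] at h
  exact Nat.eq_of_mul_eq_mul_right (Fact.out : p.Prime).pos h

variable {p : ℕ} [Fact p.Prime]

theorem neg_lt_sum_dicksonValue_even {s : ℕ} (hs : 2 ≤ s) : -((p : ℝ) ^ (2 * s) + 1) <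
    ∑ z : (ZMod p)ˣ, dicksonValue (p : ℝ) (realKloosterman p z) (2 * s) := by
  have hp : (2 : ℝ) ≤ p := by exact_mod_cast (Fact.out : p.Prime).two_le
  have h1 : ∑ z : (ZMod p)ˣ, -(2 * (p : ℝ) ^ s) ≤
      ∑ z : (ZMod p)ˣ, dicksonValue (p : ℝ) (realKloosterman p z) (2 * s) :=
    sum_le_sum fun z _ => neg_two_mul_pow_le_dicksonValue s
  rw [sum_const, card_univ, nsmul_eq_mul, card_units_zmod] at h1
  have h2 : (p : ℝ) ^ 2 ≤ (p : ℝ) ^ s := pow_le_pow_right₀ (by linarith) hs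
  have h3 : (p : ℝ) ^ (2 * s) = (p : ℝ) ^ s * (p : ℝ) ^ s := by rw [two_mul, pow_add]
  have h4 : 2 * ((p : ℝ) - 1) ≤ (p : ℝ) ^ s := by nlinarith
  have h5 : 2 * ((p : ℝ) - 1) * (p : ℝ) ^ s ≤ (p : ℝ) ^ s * (p : ℝ) ^ s :=
    mul_le_mul_of_nonneg_right h4 (by positivity)
  rw [h3]
  linarith

/-- Beyond the trivial bound on the Kloosterman sums, only their first and second moments are
needed here. -/
theorem sum_dicksonValue_three_lt (hp2 : p ≠ 2) :
    ∑ z : (ZMod p)ˣ, dicksonValue (p : ℝ) (realKloosterman p z) 3 < (p : ℝ) ^ 3 + 1 := by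
  have hp : (2 : ℝ) ≤ p := by exact_mod_cast (Fact.out : p.Prime).two_le
  have h1 : ∑ z : (ZMod p)ˣ, realKloosterman p z ^ 3 ≤
      ∑ z : (ZMod p)ˣ, ((p : ℝ) - 1) * realKloosterman p z ^ 2 := by
    refine sum_le_sum fun z _ => ?_
    rw [pow_succ']
    exact mul_le_mul_of_nonneg_right ((le_abs_self _).trans (abs_realKloosterman_le z))
      (sq_nonneg _)
  rw [← mul_sum] at h1
  have h2 := mul_le_mul_of_nonneg_left (sum_sq_realKloosterman_le hp2)
    (by linarith : (0 : ℝ) ≤ (p : ℝ) - 1)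
  have h3 := neg_le_sum_realKloosterman (p := p)
  simp only [dicksonValue_three]
  rw [sum_sub_distrib, ← mul_sum]
  nlinarith

/-- Each Dickson value is at most `2 p ^ (s + 1)` plus `|K| ^ (2 s + 1)`, and the latter sum to less
than `(p - 1) ^ (2 s - 1) * p ^ 2` by the second moment. -/
theorem sum_dicksonValue_odd_lt (hp2 : p ≠ 2) {s : ℕ} (hs : 2 ≤ s) :
    ∑ z : (ZMod p)ˣ, dicksonValue (p : ℝ) (realKloosterman p z) (2 * s + 1) <
      (p : ℝ) ^ (2 * s + 1) + 1 := by
  obtain ⟨j, rfl⟩ := Nat.exists_eq_add_of_le hs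
  have hp : (2 : ℝ) ≤ p := by exact_mod_cast (Fact.out : p.Prime).two_le
  have hp1 : (0 : ℝ) ≤ (p : ℝ) - 1 := by linarith
  have h1 : ∀ z : (ZMod p)ˣ, dicksonValue (p : ℝ) (realKloosterman p z) (2 * (2 + j) + 1) ≤
      2 * (p : ℝ) ^ (2 + j + 1) + ((p : ℝ) - 1) ^ (2 * j + 3) * realKloosterman p z ^ 2 := by
    intro z
    refine (dicksonValue_odd_le (by linarith) _).trans ?_
    rw [show 2 * (2 + j) + 1 = (2 * j + 3) + 2 by ring, pow_add |_|, sq_abs]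
    gcongr
    exact abs_realKloosterman_le z
  have h2 : ∑ z : (ZMod p)ˣ, dicksonValue (p : ℝ) (realKloosterman p z) (2 * (2 + j) + 1) ≤ _ :=
    sum_le_sum fun z _ => h1 z
  rw [sum_add_distrib, sum_const, card_univ, nsmul_eq_mul, card_units_zmod, ← mul_sum] at h2
  have h3 := sum_sq_realKloosterman_le hp2
  have h4 : ((p : ℝ) - 1) ^ (2 * j + 3) * ∑ z : (ZMod p)ˣ, realKloosterman p z ^ 2 ≤
      (p : ℝ) ^ (2 * j) * ((p : ℝ) - 1) ^ 3 * (p : ℝ) ^ 2 := by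
    rw [pow_add]
    gcongr
    · linarith
    · linarith
  have h5 : (p : ℝ) ^ (2 + j + 1) ≤ (p : ℝ) ^ (2 * j) * (p : ℝ) ^ 3 := by
    rw [← pow_add]
    exact pow_le_pow_right₀ (by linarith) (by omega)
  have h6 : ((p : ℝ) - 1) * (2 * (p : ℝ) ^ (2 + j + 1)) ≤
      ((p : ℝ) - 1) * (2 * ((p : ℝ) ^ (2 * j) * (p : ℝ) ^ 3)) := by gcongr
  have h7 : ((p : ℝ) - 1) ^ 3 + 2 * ((p : ℝ) - 1) * p ≤ (p : ℝ) ^ 3 := by nlinarith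
  have h8 := mul_le_mul_of_nonneg_left h7 (show 0 ≤ (p : ℝ) ^ (2 * j) * (p : ℝ) ^ 2 by positivity)
  have h9 : (p : ℝ) ^ (2 * (2 + j) + 1) = (p : ℝ) ^ (2 * j) * (p : ℝ) ^ 2 * (p : ℝ) ^ 3 := by ring
  rw [h9]
  linarith

/-- For `p = 2` the trivial bound `|K| ≤ 1` is already below `2 √2`, so the Dickson values are of
size `2 * 2 ^ (n / 2)`. -/
theorem abs_sum_dicksonValue_lt_of_two (hp2 : p = 2) {n : ℕ} (hn : 3 ≤ n) :
    |∑ z : (ZMod p)ˣ, dicksonValue (p : ℝ) (realKloosterman p z) n| < (2 : ℝ) ^ n - 1 := by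
  subst hp2
  have h8 : (8 : ℝ) ≤ 2 ^ n := by
    calc (8 : ℝ) = 2 ^ 3 := by norm_num
      _ ≤ 2 ^ n := pow_le_pow_right₀ (by norm_num) hn
  have h1 : ∀ z : (ZMod 2)ˣ, |dicksonValue ((2 : ℕ) : ℝ) (realKloosterman 2 z) n| <
      (2 : ℝ) ^ n - 1 := by
    intro z
    apply abs_lt_of_sq_lt_sq _ (by linarith)
    have h2 := abs_realKloosterman_le z
    have h3 : realKloosterman 2 z ^ 2 ≤ 4 * ((2 : ℕ) : ℝ) := by
      rw [← sq_abs]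
      push_cast at h2 ⊢
      nlinarith [abs_nonneg (realKloosterman 2 z)]
    refine (dicksonValue_sq_le h3 n).trans_lt ?_
    push_cast
    nlinarith
  refine (abs_sum_le_sum_abs _ _).trans_lt ((sum_lt_sum_of_nonempty univ_nonempty
    fun z _ => h1 z).trans_le ?_)
  rw [sum_const, card_univ, nsmul_eq_mul, card_units_zmod]
  norm_num

variable {E F : Type*} [Field E] [Fintype E] [DecidableEq E] [Field F] [Fintype F] [DecidableEq F]
  [Algebra (ZMod p) E] [Algebra E F] [Algebra (ZMod p) F] [IsScalarTower (ZMod p) E F]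

omit [DecidableEq E] in
theorem card_eq_pow_finrank_zmod : Fintype.card E = p ^ Module.finrank (ZMod p) E := by
  rw [Module.card_eq_pow_finrank (K := ZMod p) (V := E), ZMod.card]

theorem traceZeroCount_pos (h2 : Module.finrank E F = 2) (hn : 3 ≤ Module.finrank (ZMod p) E) :
    0 < traceZeroCount (ZMod p) E F := by
  have h := mul_traceZeroCount (p := p) (E := E) (F := F) h2
  rw [card_eq_pow_finrank_zmod (p := p)] at h
  have hp : (0 : ℝ) < p := by exact_mod_cast (Fact.out : p.Prime).pos
  suffices hlt : (0 : ℝ) < p * traceZeroCount (ZMod p) E F by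
    exact_mod_cast pos_of_mul_pos_right hlt hp.le
  rw [h]
  push_cast
  generalize Module.finrank (ZMod p) E = n at *
  rcases Nat.even_or_odd' n with ⟨s, rfl | rfl⟩
  · have := neg_lt_sum_dicksonValue_even (p := p) (s := s) (by omega)
    rw [pow_mul (-1 : ℝ)]
    norm_num
    linarith
  · rw [pow_succ (-1 : ℝ), pow_mul (-1 : ℝ)]
    norm_num
    by_cases hp2 : p = 2
    · have := (abs_lt.1 (abs_sum_dicksonValue_lt_of_two hp2 hn)).2
      subst hp2
      push_cast at this ⊢
      linarith
    · rcases Nat.eq_or_lt_of_le (show 1 ≤ s by omega) with rfl | hs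
      · have := sum_dicksonValue_three_lt hp2
        norm_num
        linarith
      · have := sum_dicksonValue_odd_lt hp2 hs
        linarith

/-- For odd `p` this is a matter of parity; for `p = 2` it follows from the bound on `S`. -/
theorem traceZeroCount_ne_one (h2 : Module.finrank E F = 2)
    (hn : 3 ≤ Module.finrank (ZMod p) E) : traceZeroCount (ZMod p) E F ≠ 1 := by
  intro h1
  by_cases hp2 : p = 2
  · have h := mul_traceZeroCount (p := p) (E := E) (F := F) h2
    have hlt := abs_sum_dicksonValue_lt_of_two hp2 hn
    rw [card_eq_pow_finrank_zmod (p := p), h1] at h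
    subst hp2
    push_cast at h hlt
    have habs : |(-1 : ℝ) ^ Module.finrank (ZMod 2) E *
        ∑ z : (ZMod 2)ˣ, dicksonValue (2 : ℝ) (realKloosterman 2 z) (Module.finrank (ZMod 2) E)| <
        2 ^ Module.finrank (ZMod 2) E - 1 := by
      rwa [abs_mul, abs_pow, abs_neg, abs_one, one_pow, one_mul]
    have := (abs_lt.1 habs).1
    linarith
  · have := even_traceZeroCount (k := ZMod p) (E := E) (F := F) ?_ ?_
    · rw [h1] at this
      exact Nat.not_even_one this
    · intro h
      have := charP_of_injective_algebraMap (algebraMap (ZMod p) F).injective p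
      have h3 : ((2 : ℕ) : F) = 0 := by exact_mod_cast h
      rw [CharP.cast_eq_zero_iff F p] at h3
      exact hp2 ((Nat.prime_dvd_prime_iff_eq Fact.out Nat.prime_two).1 h3)
    · rw [card_eq_pow_finrank_zmod (p := p)]
      exact ((Fact.out : p.Prime).odd_of_ne_two hp2).pow

omit [DecidableEq E] in
/-- The two sides have different parity: `u ↦ -u` acts freely for odd `p`, and `u ↦ u⁻¹` has the
single fixed point `1` for `p = 2`. -/
theorem traceZeroCount_ne_pow (h2 : Module.finrank E F = 2) {n : ℕ} (hn : n ≠ 0) :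
    traceZeroCount (ZMod p) E F ≠ p ^ n := by
  have := charP_of_injective_algebraMap (algebraMap (ZMod p) F).injective p
  have h2p : ((2 : ℕ) : F) = 0 ↔ p = 2 := by
    rw [CharP.cast_eq_zero_iff F p, Nat.prime_dvd_prime_iff_eq Fact.out Nat.prime_two]
  rw [Nat.cast_ofNat] at h2p
  intro h
  by_cases hp2 : p = 2
  · have h3 := odd_traceZeroCount (k := ZMod p) (E := E) (h2p.2 hp2) h2
    rw [h, Nat.odd_pow_iff hn, hp2] at h3
    exact absurd h3 (by decide)
  · have hodd := (Fact.out : p.Prime).odd_of_ne_two hp2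
    have h3 := even_traceZeroCount (k := ZMod p) (E := E) (F := F) (fun h => hp2 (h2p.1 h)) (by
      rw [card_eq_pow_finrank_zmod (p := p)]
      exact hodd.pow)
    rw [h] at h3
    exact Nat.not_even_iff_odd.2 hodd.pow h3

theorem traceZeroCount_lt (h2 : Module.finrank E F = 2) :
    traceZeroCount (ZMod p) E F < Fintype.card E + 1 := by
  obtain ⟨n, hn⟩ : ∃ n, Module.finrank (ZMod p) E = n + 1 :=
    ⟨Module.finrank (ZMod p) E - 1, by
      have := Module.finrank_pos (R := ZMod p) (M := E); omega⟩
  have hE := card_eq_pow_finrank_zmod (p := p) (E := E)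
  rw [hn] at hE
  have h := traceZeroCount_le (k := ZMod p) (E := E) (F := F) h2
  rw [card_filter_trace_eq hE] at h
  have h3 := Nat.mul_le_mul_left (p ^ n) (Fact.out : p.Prime).two_le
  rw [hE, pow_succ]
  omega

end Bounds

/-! ### Weights of codewords -/

section Weights

variable {p : ℕ} [Fact p.Prime]

section

variable {F : Type*} [Field F] [Fintype F] [DecidableEq F] [Algebra (ZMod p) F]

/-- The linear map sending `(a, b)` to the codeword `(Tr (a x + b y))` indexed by `D`. -/
noncomputable def codeMap (D : Finset (F × F)) : F × F →ₗ[ZMod p] (D → ZMod p) where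
  toFun v d := Algebra.trace (ZMod p) F (v.1 * (d : F × F).1 + v.2 * (d : F × F).2)
  map_add' v w := by
    funext d
    rw [Pi.add_apply, ← map_add]
    congr 1
    simp only [Prod.fst_add, Prod.snd_add]
    ring
  map_smul' r v := by
    funext d
    rw [Pi.smul_apply, ← map_smul]
    simp [smul_add]

omit [Fintype F] [DecidableEq F] in
theorem codeOf_eq_range (D : Finset (F × F)) :
    codeOf p D = LinearMap.range (codeMap (p := p) D) := by
  ext c
  constructor
  · rintro ⟨a, b, rfl⟩
    exact ⟨(a, b), rfl⟩
  · rintro ⟨v, rfl⟩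
    exact ⟨v.1, v.2, rfl⟩

/-- The number of pairs, `(0, 0)` included, that satisfy the equation of the defining set and at
which the codeword of `(a, b)` vanishes. -/
noncomputable def zeroCount (p N : ℕ) [Fact p.Prime] [Algebra (ZMod p) F] (a b : F) : ℕ :=
  #{d : F × F | Algebra.trace (ZMod p) F (d.1 + d.2 ^ N) = 0 ∧
    Algebra.trace (ZMod p) F (a * d.1 + b * d.2) = 0}

omit [Field F] [DecidableEq F] in
theorem sum_fiber_snd (P : F → F → Prop) [∀ x y, Decidable (P x y)] :
    #{d : F × F | P d.1 d.2} = ∑ y : F, #{x : F | P x y} := by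
  simp only [card_filter]
  rw [Fintype.sum_prod_type_right]

omit [DecidableEq F] in
theorem card_trace_add_eq_zero {m : ℕ} (hF : Fintype.card F = p ^ (m + 1))
    (g : F → F) :
    #{d : F × F | Algebra.trace (ZMod p) F (d.1 + g d.2) = 0} = p ^ (2 * m + 1) := by
  rw [sum_fiber_snd (fun x y => Algebra.trace (ZMod p) F (x + g y) = 0)]
  have h : ∀ y : F, #{x : F | Algebra.trace (ZMod p) F (x + g y) = 0} = p ^ m := by
    intro y
    rw [← card_filter_trace_eq hF (-Algebra.trace (ZMod p) F (g y))]
    congr 1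
    ext x
    simp only [mem_filter, map_add, mem_univ, true_and, eq_neg_iff_add_eq_zero]
  rw [sum_congr rfl fun y _ => h y, sum_const, card_univ, hF, smul_eq_mul, ← pow_add]
  congr 1
  omega

theorem insert_definingSet {t : ℕ} (ht : 2 ≤ p ^ t) :
    (univ.filter fun d : F × F => Algebra.trace (ZMod p) F (d.1 + d.2 ^ (p ^ t - 1)) = 0) =
      insert (0, 0) (definingSet p t F) := by
  ext d
  simp only [definingSet, mem_filter, mem_univ, true_and, mem_insert]
  by_cases hd : d = (0, 0)
  · subst hd
    simp [zero_pow (show p ^ t - 1 ≠ 0 by omega)]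
  · simp [hd]

theorem card_definingSet_add_one {m : ℕ} (hF : Fintype.card F = p ^ (m + 1)) {t : ℕ}
    (ht : 2 ≤ p ^ t) : #(definingSet p t F) + 1 = p ^ (2 * m + 1) := by
  rw [← card_trace_add_eq_zero hF (fun y => y ^ (p ^ t - 1)), insert_definingSet ht,
    card_insert_of_notMem]
  simp [definingSet]

theorem hammingNorm_codeMap_add_zeroCount {m : ℕ} (hF : Fintype.card F = p ^ (m + 1)) {t : ℕ}
    (ht : 2 ≤ p ^ t) (a b : F) :
    hammingNorm (codeMap (p := p) (definingSet p t F) (a, b)) + zeroCount p (p ^ t - 1) a b =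
      p ^ (2 * m + 1) := by
  set T := univ.filter fun d : F × F => Algebra.trace (ZMod p) F (d.1 + d.2 ^ (p ^ t - 1)) = 0
    with hT
  have hz : zeroCount p (p ^ t - 1) a b =
      #(T.filter fun d => Algebra.trace (ZMod p) F (a * d.1 + b * d.2) = 0) := by
    rw [hT, filter_filter]
    rfl
  have hn : hammingNorm (codeMap (p := p) (definingSet p t F) (a, b)) =
      #(T.filter fun d => ¬ Algebra.trace (ZMod p) F (a * d.1 + b * d.2) = 0) := by
    rw [hammingNorm]
    refine card_bij (fun d _ => (d : F × F)) ?_ (fun x _ y _ h => Subtype.ext h) ?_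
    · intro d hd
      rw [mem_filter, hT, insert_definingSet ht]
      exact ⟨mem_insert_of_mem d.2, (mem_filter.1 hd).2⟩
    · intro d hd
      rw [mem_filter, hT, insert_definingSet ht, mem_insert] at hd
      obtain ⟨rfl | h1, h2⟩ := hd
      · simp at h2
      · exact ⟨⟨d, h1⟩, mem_filter.2 ⟨mem_univ _, h2⟩, rfl⟩
  rw [hz, hn, add_comm, card_filter_add_card_filter_not,
    ← card_trace_add_eq_zero hF (fun y => y ^ (p ^ t - 1))]

omit [DecidableEq F] in
theorem card_filter_trace_mul_eq {m : ℕ} (hF : Fintype.card F = p ^ (m + 1)) {b : F} (hb : b ≠ 0) (s : ZMod p) :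
    #{y : F | Algebra.trace (ZMod p) F (b * y) = s} = p ^ m := by
  rw [← card_filter_trace_eq hF s]
  refine card_bij (fun y _ => b * y) ?_ ?_ ?_
  · intro y hy
    simpa using hy
  · intro x _ y _ h
    exact mul_left_cancel₀ hb h
  · intro y hy
    exact ⟨b⁻¹ * y, by simpa [hb] using hy, by simp [hb]⟩

omit [DecidableEq F] in
theorem zeroCount_zero {m : ℕ} (hF : Fintype.card F = p ^ (m + 1)) {N : ℕ} {b : F}
    (hb : b ≠ 0) : zeroCount p N (0 : F) b = p ^ (2 * m) := by
  rw [zeroCount, sum_fiber_snd (fun x y => Algebra.trace (ZMod p) F (x + y ^ N) = 0 ∧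
    Algebra.trace (ZMod p) F (0 * x + b * y) = 0)]
  have h : ∀ y : F, #{x : F | Algebra.trace (ZMod p) F (x + y ^ N) = 0 ∧
      Algebra.trace (ZMod p) F (0 * x + b * y) = 0} =
      if Algebra.trace (ZMod p) F (b * y) = 0 then p ^ m else 0 := by
    intro y
    split_ifs with hy
    · rw [← card_filter_trace_eq hF (-Algebra.trace (ZMod p) F (y ^ N))]
      congr 1
      ext x
      simp only [mem_filter, map_add, mem_univ, true_and, zero_mul, zero_add, hy, and_true,
        eq_neg_iff_add_eq_zero]
    · simp [hy]
  rw [sum_congr rfl fun y _ => h y, ← sum_filter, sum_const, card_filter_trace_mul_eq hF hb,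
    smul_eq_mul, ← pow_add, two_mul]

omit [DecidableEq F] in
/-- If `a` is not in the prime field, then `x ↦ Tr x` and `x ↦ Tr (a x)` are linearly
independent. -/
theorem surjective_trace_prod {a : F} (ha : ∀ c : ZMod p, algebraMap (ZMod p) F c ≠ a) :
    Function.Surjective ((Algebra.trace (ZMod p) F).prod
      ((Algebra.trace (ZMod p) F).comp (LinearMap.mulLeft (ZMod p) a))) := by
  rw [← LinearMap.range_eq_top]
  by_contra hne
  obtain ⟨f, hf, hle⟩ := Submodule.exists_le_ker_of_lt_top _ (lt_top_iff_ne_top.2 hne)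
  have hfx : ∀ u v, f (u, v) = f (1, 0) * u + f (0, 1) * v := by
    intro u v
    have : ((u, v) : ZMod p × ZMod p) = u • (1, 0) + v • (0, 1) := by simp
    rw [this, map_add, map_smul, map_smul, smul_eq_mul, smul_eq_mul]
    ring
  have hzero : ∀ x, Algebra.trace (ZMod p) F
      ((algebraMap (ZMod p) F (f (1, 0)) + algebraMap (ZMod p) F (f (0, 1)) * a) * x) = 0 := by
    intro x
    have h1 := hle ⟨x, rfl⟩
    rw [LinearMap.mem_ker] at h1
    change f (Algebra.trace (ZMod p) F x, Algebra.trace (ZMod p) F (a * x)) = 0 at h1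
    rw [hfx, ← smul_eq_mul, ← smul_eq_mul, ← map_smul, ← map_smul, ← map_add] at h1
    refine Eq.trans ?_ h1
    rw [Algebra.smul_def, Algebra.smul_def]
    congr 1
    ring
  have h0 := (traceForm_nondegenerate (ZMod p) F).1 _ hzero
  apply hf
  by_cases hv : f (0, 1) = 0
  · rw [hv, map_zero, zero_mul, add_zero, map_eq_zero] at h0
    ext <;> simp [hv, h0]
  · exfalso
    apply ha (-(f (1, 0) / f (0, 1)))
    have hv' : algebraMap (ZMod p) F (f (0, 1)) ≠ 0 := by rwa [Ne, map_eq_zero]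
    rw [map_neg, map_div₀]
    field_simp
    linear_combination -h0

omit [DecidableEq F] in
theorem zeroCount_of_forall_ne {m : ℕ} (hF : Fintype.card F = p ^ (m + 1)) {N : ℕ} {a : F}
    (b : F) (ha : ∀ c : ZMod p, algebraMap (ZMod p) F c ≠ a) :
    zeroCount p N a b = p ^ (2 * m) := by
  have hp := (Fact.out : p.Prime).pos
  rw [zeroCount, sum_fiber_snd (fun x y => Algebra.trace (ZMod p) F (x + y ^ N) = 0 ∧
    Algebra.trace (ZMod p) F (a * x + b * y) = 0)]
  have h : ∀ y : F, #{x : F | Algebra.trace (ZMod p) F (x + y ^ N) = 0 ∧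
      Algebra.trace (ZMod p) F (a * x + b * y) = 0} * p ^ 2 = p ^ (m + 1) := by
    intro y
    have h1 := card_filter_eq_mul_card ((Algebra.trace (ZMod p) F).prod
      ((Algebra.trace (ZMod p) F).comp (LinearMap.mulLeft (ZMod p) a))).toAddMonoidHom
      (surjective_trace_prod ha)
      (-Algebra.trace (ZMod p) F (y ^ N), -Algebra.trace (ZMod p) F (b * y))
    rw [Fintype.card_prod, ZMod.card, ← sq, hF] at h1
    rw [← h1]
    congr 2
    ext x
    simp [eq_neg_iff_add_eq_zero]
  apply Nat.eq_of_mul_eq_mul_right (pow_pos hp 2)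
  rw [sum_mul, sum_congr rfl fun y _ => h y, sum_const, card_univ, hF, smul_eq_mul]
  ring

omit [DecidableEq F] in
theorem zeroCount_algebraMap {m : ℕ} (hF : Fintype.card F = p ^ (m + 1)) {N : ℕ} (c : ZMod p)
    (b : F) : zeroCount p N (algebraMap (ZMod p) F c) b = p ^ m *
      #{y : F | Algebra.trace (ZMod p) F (b * y) = c * Algebra.trace (ZMod p) F (y ^ N)} := by
  rw [zeroCount, sum_fiber_snd (fun x y => Algebra.trace (ZMod p) F (x + y ^ N) = 0 ∧
    Algebra.trace (ZMod p) F (algebraMap (ZMod p) F c * x + b * y) = 0)]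
  have h : ∀ y : F, #{x : F | Algebra.trace (ZMod p) F (x + y ^ N) = 0 ∧
      Algebra.trace (ZMod p) F (algebraMap (ZMod p) F c * x + b * y) = 0} =
      if Algebra.trace (ZMod p) F (b * y) = c * Algebra.trace (ZMod p) F (y ^ N)
        then p ^ m else 0 := by
    intro y
    have h1 : ∀ x : F, (Algebra.trace (ZMod p) F (x + y ^ N) = 0 ∧
        Algebra.trace (ZMod p) F (algebraMap (ZMod p) F c * x + b * y) = 0) ↔
        (Algebra.trace (ZMod p) F x = -Algebra.trace (ZMod p) F (y ^ N) ∧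
        Algebra.trace (ZMod p) F (b * y) = c * Algebra.trace (ZMod p) F (y ^ N)) := by
      intro x
      rw [map_add, map_add, ← Algebra.smul_def, map_smul, smul_eq_mul, ← eq_neg_iff_add_eq_zero]
      refine and_congr_right fun hx => ?_
      rw [hx, mul_neg, neg_add_eq_zero, eq_comm]
    simp only [h1]
    split_ifs with hy
    · simp only [hy, and_true]
      exact card_filter_trace_eq hF _
    · simp [hy]
  rw [sum_congr rfl fun y _ => h y, ← sum_filter, sum_const, smul_eq_mul, mul_comm]

end

variable {E F : Type*} [Field E] [Fintype E] [DecidableEq E] [Field F] [Fintype F] [DecidableEq F]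
  [Algebra (ZMod p) E] [Algebra E F] [Algebra (ZMod p) F] [IsScalarTower (ZMod p) E F]

omit [DecidableEq E] [Algebra (ZMod p) E] [IsScalarTower (ZMod p) E F] in
theorem card_units_trace_pow_eq_zero (h2 : Module.finrank E F = 2) :
    #{y : Fˣ | Algebra.trace (ZMod p) F ((y : F) ^ (Fintype.card E - 1)) = 0} =
      (Fintype.card E - 1) * traceZeroCount (ZMod p) E F := by
  rw [card_filter, sum_pow_card_sub_one h2 (fun v => if Algebra.trace (ZMod p) F v = 0 then 1
    else 0), traceZeroCount, card_filter, smul_eq_mul]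

theorem card_filter_eq_card_units_add {K : Type*} [Field K] [Fintype K] [DecidableEq K] (P : K → Prop)
    [DecidablePred P] : #{y : K | P y} = #{y : Kˣ | P y} + if P 0 then 1 else 0 := by
  have h : #{y : Kˣ | P y} = #((univ.filter P).erase 0) := by
    refine card_bij (fun y _ => (y : K)) ?_ (fun x _ y _ h => Units.ext h) ?_
    · intro y hy
      exact mem_erase.2 ⟨y.ne_zero, mem_filter.2 ⟨mem_univ _, (mem_filter.1 hy).2⟩⟩
    · intro y hy
      obtain ⟨h1, h2⟩ := mem_erase.1 hy
      exact ⟨Units.mk0 y h1, mem_filter.2 ⟨mem_univ _, (mem_filter.1 h2).2⟩, rfl⟩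
  rw [h]
  split_ifs with h0
  · rw [card_erase_add_one (mem_filter.2 ⟨mem_univ _, h0⟩)]
  · rw [erase_eq_of_notMem (by simpa using h0), add_zero]

/-- The solutions `y` are counted along the `Eˣ`-orbits, on which `y ^ (|E| - 1)` is constant
while `Tr (b y)` varies through the trace form of `E`. -/
theorem card_trace_mul_eq_add_traceZeroCount (h2 : Module.finrank E F = 2) {n : ℕ}
    (hE : Fintype.card E = p ^ (n + 1)) {c : ZMod p} (hc : c ≠ 0) {b : F} (hb : b ≠ 0) :
    #{y : F | Algebra.trace (ZMod p) F (b * y) =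
      c * Algebra.trace (ZMod p) F (y ^ (Fintype.card E - 1))} + traceZeroCount (ZMod p) E F =
      1 + Fintype.card E * p ^ n +
        if Algebra.trace (ZMod p) F (b ^ (Fintype.card E - 1)) = 0 then Fintype.card E else 0 := by
  have hQ : 1 < Fintype.card E := Fintype.one_lt_card
  set Q := Fintype.card E with hQdef
  set N₀ := traceZeroCount (ZMod p) E F with hN₀
  set δ := if Algebra.trace (ZMod p) F (b ^ (Q - 1)) = 0 then Q else 0 with hδ
  have hcardF : Fintype.card Fˣ = (Q - 1) * (Q + 1) := by
    rw [Fintype.card_units, Module.card_eq_pow_finrank (K := E) (V := F), h2, mul_comm,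
      ← Nat.sq_sub_sq, one_pow]
  set M := #{y : Fˣ | Algebra.trace (ZMod p) F (b * y) =
    c * Algebra.trace (ZMod p) F ((y : F) ^ (Q - 1))} with hM
  have hfix : ∀ e : Eˣ, (algebraMap E F e) ^ (Q - 1) = 1 := by
    intro e
    rw [← map_pow, FiniteField.pow_card_sub_one_eq_one _ e.ne_zero, map_one]
  -- the number of solutions is averaged over the scalings `y ↦ e y` with `e ∈ Eˣ`
  have hscale : (Q - 1) * M = ∑ y : Fˣ, #{e : Eˣ | Algebra.trace (ZMod p) F
      (b * (algebraMap E F e * y)) = c * Algebra.trace (ZMod p) F ((y : F) ^ (Q - 1))} := by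
    simp only [card_filter]
    rw [sum_comm]
    have h : ∀ e : Eˣ, (∑ y : Fˣ, if Algebra.trace (ZMod p) F (b * (algebraMap E F e * y)) =
        c * Algebra.trace (ZMod p) F ((y : F) ^ (Q - 1)) then 1 else 0) = M := by
      intro e
      rw [hM, card_filter]
      refine Fintype.sum_equiv (Equiv.mulLeft (Units.map (algebraMap E F).toMonoidHom e)) _ _ ?_
      intro y
      simp only [Equiv.coe_mulLeft, Units.val_mul, Units.coe_map, mul_pow]
      change _ = if Algebra.trace (ZMod p) F (b * (algebraMap E F e * y)) = c *
        Algebra.trace (ZMod p) F (algebraMap E F e ^ (Q - 1) * (y : F) ^ (Q - 1)) then 1 else 0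
      rw [hfix, one_mul]
    rw [sum_congr rfl fun e _ => h e, sum_const, card_univ, Fintype.card_units, smul_eq_mul]
  -- where the trace to `E` vanishes, `y ^ (Q - 1) = -(b ^ (Q - 1))⁻¹`, and inversion on `normOne`
  -- preserves traces
  have htau : ∀ y : Fˣ, Algebra.trace E F (b * y) = 0 →
      (Algebra.trace (ZMod p) F ((y : F) ^ (Q - 1)) = 0 ↔
        Algebra.trace (ZMod p) F (b ^ (Q - 1)) = 0) := by
    intro y hy
    have h1 := algebraMap_trace_eq_add_pow h2 (b * (y : F))
    have hby : b * (y : F) ≠ 0 := mul_ne_zero hb y.ne_zero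
    rw [hy, map_zero, ← hQdef, ← Nat.sub_add_cancel hQ.le, pow_succ] at h1
    have h3 : b ^ (Q - 1) * (y : F) ^ (Q - 1) = -1 := by
      rw [← mul_pow]
      apply mul_right_cancel₀ hby
      linear_combination -h1
    have hv : (y : F) ^ (Q - 1) ∈ normOne E F := by
      rw [mem_normOne, ← pow_mul, ← hQdef, ← hcardF, Fintype.card_units,
        FiniteField.pow_card_sub_one_eq_one _ y.ne_zero]
    have h4 : b ^ (Q - 1) = -((y : F) ^ (Q - 1))⁻¹ := by
      apply mul_right_cancel₀ (ne_zero_of_mem_normOne hv)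
      rw [h3, neg_mul, inv_mul_cancel₀ (ne_zero_of_mem_normOne hv)]
    rw [h4, map_neg, trace_inv_of_mem_normOne h2 hv, neg_eq_zero]
  -- the second summand on the left restores the solution `e = 0`, so that all of `E` is counted
  have hper : ∀ y : Fˣ, #{e : Eˣ | Algebra.trace (ZMod p) F (b * (algebraMap E F e * y)) =
      c * Algebra.trace (ZMod p) F ((y : F) ^ (Q - 1))} +
      (if Algebra.trace (ZMod p) F ((y : F) ^ (Q - 1)) = 0 then 1 else 0) =
      if Algebra.trace E F (b * y) = 0 then δ else p ^ n := by
    intro y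
    have h1 := card_filter_eq_card_units_add (fun e : E =>
      Algebra.trace (ZMod p) F (b * (algebraMap E F e * y)) =
      c * Algebra.trace (ZMod p) F ((y : F) ^ (Q - 1)))
    have h3 : Algebra.trace (ZMod p) F (b * (algebraMap E F 0 * y)) =
        c * Algebra.trace (ZMod p) F ((y : F) ^ (Q - 1)) ↔
        Algebra.trace (ZMod p) F ((y : F) ^ (Q - 1)) = 0 := by
      rw [map_zero, zero_mul, mul_zero, map_zero, eq_comm, mul_eq_zero, or_iff_right hc]
    simp only [h3] at h1
    rw [← h1]
    have h4 : ∀ e : E, Algebra.trace (ZMod p) F (b * (algebraMap E F e * y)) =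
        Algebra.trace (ZMod p) E (Algebra.trace E F (b * y) * e) := by
      intro e
      rw [← Algebra.trace_trace (S := E) (T := F), mul_left_comm, ← Algebra.smul_def, map_smul,
        smul_eq_mul, mul_comm]
    simp only [h4]
    split_ifs with hT
    · simp only [hT, zero_mul, map_zero]
      have h5 : (0 = c * Algebra.trace (ZMod p) F ((y : F) ^ (Q - 1))) ↔
          Algebra.trace (ZMod p) F (b ^ (Q - 1)) = 0 := by
        rw [← htau y hT, eq_comm, mul_eq_zero, or_iff_right hc]
      simp only [h5, hδ]
      by_cases hδ0 : Algebra.trace (ZMod p) F (b ^ (Q - 1)) = 0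
      · simp only [hδ0, filter_true, card_univ, if_true, ← hQdef]
      · simp only [hδ0, filter_false, card_empty, if_false]
    · exact card_filter_trace_mul_eq hE hT _
  have hT : #{y : Fˣ | Algebra.trace E F (b * y) = 0} + 1 = Q := by
    have h1 := card_filter_eq_card_units_add (fun y : F => Algebra.trace E F (b * y) = 0)
    rw [if_pos (by rw [mul_zero, map_zero])] at h1
    rw [← h1]
    have h3 := card_filter_eq_mul_card ((Algebra.trace E F).comp
      (LinearMap.mulLeft E b)).toAddMonoidHom (by
        intro s
        obtain ⟨x, hx⟩ := Algebra.trace_surjective E F s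
        refine ⟨b⁻¹ * x, ?_⟩
        rw [← hx]
        simp [hb]) 0
    rw [Module.card_eq_pow_finrank (K := E) (V := F), h2, sq] at h3
    exact Nat.eq_of_mul_eq_mul_right (by omega) h3
  have hsum := sum_congr (rfl : (univ : Finset Fˣ) = univ) fun y _ => hper y
  rw [sum_add_distrib, ← hscale, ← card_filter, card_units_trace_pow_eq_zero h2, ← hQdef, ← hN₀,
    sum_ite, sum_const, sum_const, smul_eq_mul, smul_eq_mul] at hsum
  have hT' := card_filter_add_card_filter_not (s := (univ : Finset Fˣ))
    (fun y : Fˣ => Algebra.trace E F (b * y) = 0)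
  rw [card_univ, hcardF] at hT'
  have hmain := card_filter_eq_card_units_add (fun y : F => Algebra.trace (ZMod p) F (b * y) =
      c * Algebra.trace (ZMod p) F (y ^ (Q - 1)))
  rw [if_pos (by rw [mul_zero, zero_pow (by omega), map_zero, mul_zero])] at hmain
  rw [hmain, ← hM]
  obtain ⟨R, hR⟩ : ∃ R, Q = R + 1 := ⟨Q - 1, by omega⟩
  rw [hR, Nat.add_sub_cancel] at hsum hT'
  have hTR : #{y : Fˣ | Algebra.trace E F (b * y) = 0} = R := by omega
  rw [hTR] at hsum hT'
  have hT'' : #{y : Fˣ | ¬ Algebra.trace E F (b * y) = 0} = R * (R + 1) := by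
    have : R * (R + 1 + 1) = R * (R + 1) + R := by ring
    omega
  rw [hT''] at hsum
  have hR0 : 0 < R := by omega
  have : M + N₀ = δ + (R + 1) * p ^ n := by
    apply Nat.eq_of_mul_eq_mul_left hR0
    rw [mul_add, mul_add, ← mul_assoc]
    exact hsum
  rw [hR]
  omega

end Weights

/-! ### Multiplicities and the sum `S` -/

section WeightDistribution

variable {p : ℕ} [Fact p.Prime]

theorem sum_eq_sum_algebraMap_add {F : Type*} [Field F] [Fintype F] [DecidableEq F]
    [Algebra (ZMod p) F] (g : F → ℕ) :
    ∑ a : F, g a = ∑ c : ZMod p, g (algebraMap (ZMod p) F c) +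
      ∑ a : F with ∀ c : ZMod p, algebraMap (ZMod p) F c ≠ a, g a := by
  rw [← sum_filter_add_sum_filter_not univ
    (fun a : F => ∀ c : ZMod p, algebraMap (ZMod p) F c ≠ a), add_comm]
  congr 1
  symm
  refine sum_bij (fun c _ => algebraMap (ZMod p) F c) ?_
    (fun x _ y _ h => (algebraMap (ZMod p) F).injective h) ?_ (fun _ _ => rfl)
  · intro c _
    simp
  · intro a ha
    have h := (mem_filter.1 ha).2
    push Not at h
    obtain ⟨c, hc⟩ := h
    exact ⟨c, mem_univ _, hc⟩

/-- The distribution of a function of `(a, b)` that is constant on each of the four classes: `a`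
outside the prime field or `a = 0`, `b ≠ 0`; `a` a nonzero scalar and `b = 0`; `a` a nonzero scalar
and `b ≠ 0` with or without the property `T`. -/
theorem card_filter_eq_of_classes {F : Type*} [Field F] [Fintype F] [DecidableEq F]
    [Algebra (ZMod p) F] {f : F → F → ℕ} {T : F → Prop} [DecidablePred T] {w₁ w₂ w₃ w₄ : ℕ}
    (h0 : f 0 0 = 0) (h1 : ∀ b, b ≠ 0 → f 0 b = w₁)
    (h1' : ∀ a b, (∀ c : ZMod p, algebraMap (ZMod p) F c ≠ a) → f a b = w₁)
    (h2 : ∀ c : ZMod p, c ≠ 0 → f (algebraMap (ZMod p) F c) 0 = w₂)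
    (h3 : ∀ (c : ZMod p) b, c ≠ 0 → b ≠ 0 → T b → f (algebraMap (ZMod p) F c) b = w₃)
    (h4 : ∀ (c : ZMod p) b, c ≠ 0 → b ≠ 0 → ¬ T b → f (algebraMap (ZMod p) F c) b = w₄) (k : ℕ) :
    #{v : F × F | f v.1 v.2 = k} = (if k = 0 then 1 else 0) +
      (if k = w₁ then Fintype.card F * (Fintype.card F - p) + (Fintype.card F - 1) else 0) +
      (if k = w₂ then p - 1 else 0) +
      (if k = w₃ then (p - 1) * #{b : Fˣ | T b} else 0) +
      (if k = w₄ then (p - 1) * #{b : Fˣ | ¬ T b} else 0) := by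
  have hsplit : ∀ g : F → ℕ, ∑ b : F, g b = g 0 + ∑ b : Fˣ, g b := by
    intro g
    rw [← add_sum_erase univ g (mem_univ 0)]
    congr 1
    symm
    refine sum_bij (fun y _ => (y : F)) (fun y _ => by simp) (fun x _ y _ h => Units.ext h) ?_
      (fun _ _ => rfl)
    intro y hy
    exact ⟨Units.mk0 y (ne_of_mem_erase hy), mem_univ _, rfl⟩
  have hcount := sum_eq_sum_algebraMap_add (p := p) (fun _ : F => 1)
  simp only [sum_const, card_univ, ZMod.card, smul_eq_mul, mul_one] at hcount
  rw [card_filter, Fintype.sum_prod_type, sum_eq_sum_algebraMap_add (p := p)]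
  rw [← add_sum_erase univ _ (mem_univ (0 : ZMod p)), map_zero]
  have e0 : (∑ b : F, if f 0 b = k then 1 else 0) =
      (if k = 0 then 1 else 0) + if k = w₁ then Fintype.card F - 1 else 0 := by
    rw [hsplit, h0, sum_congr rfl fun b _ => by rw [h1 _ b.ne_zero], sum_const, card_univ,
      Fintype.card_units]
    simp only [eq_comm (b := k), smul_eq_mul, mul_ite, mul_one, mul_zero]
  have e1 : (∑ a : F with ∀ c : ZMod p, algebraMap (ZMod p) F c ≠ a,
      ∑ b : F, if f a b = k then 1 else 0) =
      if k = w₁ then Fintype.card F * (Fintype.card F - p) else 0 := by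
    rw [sum_congr rfl fun a ha => sum_congr rfl fun b _ => by rw [h1' a b (mem_filter.1 ha).2],
      sum_const, sum_const, card_univ]
    rw [show Fintype.card F - p = #{a : F | ∀ c : ZMod p, algebraMap (ZMod p) F c ≠ a} by omega]
    simp only [eq_comm (b := k), smul_eq_mul, mul_ite, mul_one, mul_zero]
    rw [mul_comm]
  have e2 : ∀ c ∈ univ.erase (0 : ZMod p),
      (∑ b : F, if f (algebraMap (ZMod p) F c) b = k then 1 else 0) =
      (if k = w₂ then 1 else 0) + (if k = w₃ then #{b : Fˣ | T b} else 0) +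
        (if k = w₄ then #{b : Fˣ | ¬ T b} else 0) := by
    intro c hc
    have hc0 := ne_of_mem_erase hc
    rw [hsplit, h2 c hc0, ← sum_filter_add_sum_filter_not univ (fun b : Fˣ => T b),
      sum_congr rfl fun b hb => by rw [h3 c b hc0 b.ne_zero (mem_filter.1 hb).2],
      sum_congr (s₁ := univ.filter fun b : Fˣ => ¬ T b) rfl fun b hb => by
        rw [h4 c b hc0 b.ne_zero (mem_filter.1 hb).2], sum_const, sum_const]
    simp only [eq_comm (b := k), smul_eq_mul, mul_ite, mul_one, mul_zero, add_assoc]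
  rw [e0, e1, sum_congr rfl e2, sum_const, card_erase_of_mem (mem_univ _), card_univ, ZMod.card,
    smul_eq_mul, mul_add, mul_add, mul_ite, mul_ite, mul_ite, mul_one, mul_zero]
  split_ifs <;> omega

/-- Codewords correspond to pairs `(a, b)` once the parametrization is injective. -/
theorem weightCount_codeOf {F : Type*} [Field F] [Fintype F] [DecidableEq F] [Algebra (ZMod p) F]
    {D : Finset (F × F)} (hinj : Function.Injective (codeMap (p := p) D)) (k : ℕ) :
    weightCount (codeOf p D) k = #{v : F × F | hammingNorm (codeMap (p := p) D (v.1, v.2)) = k} := by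
  rw [weightCount, ← Set.ncard_coe_finset, ← Set.ncard_image_of_injective _ hinj]
  congr 1
  ext c
  simp only [codeOf_eq_range, LinearMap.mem_range, Set.mem_ofPred_eq, coe_filter, mem_univ,
    true_and, Set.mem_image]
  constructor
  · rintro ⟨⟨v, rfl⟩, h⟩
    exact ⟨v, h, rfl⟩
  · rintro ⟨v, h, rfl⟩
    exact ⟨⟨v, rfl⟩, h⟩

theorem setOf_weightCount_ne_zero {ι : Type*} [Fintype ι] {C : Submodule (ZMod p) (ι → ZMod p)}
    {w₁ w₂ w₃ w₄ A₁ A₂ A₃ A₄ : ℕ} (hw : 0 < w₁ ∧ 0 < w₂ ∧ 0 < w₃ ∧ 0 < w₄)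
    (hA : 0 < A₁ ∧ 0 < A₂ ∧ 0 < A₃ ∧ 0 < A₄)
    (h : ∀ k : ℕ, weightCount C k =
        (if k = 0 then 1 else 0) + (if k = w₁ then A₁ else 0) + (if k = w₂ then A₂ else 0)
          + (if k = w₃ then A₃ else 0) + (if k = w₄ then A₄ else 0)) :
    {k : ℕ | k ≠ 0 ∧ weightCount C k ≠ 0} = (({w₁, w₂, w₃, w₄} : Finset ℕ) : Set ℕ) := by
  ext k
  simp only [Set.mem_ofPred_eq, h, coe_insert, coe_singleton, Set.mem_insert_iff,
    Set.mem_singleton_iff]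
  constructor
  · rintro ⟨hk, hne⟩
    by_contra! hcon
    rw [if_neg hk, if_neg hcon.1, if_neg hcon.2.1, if_neg hcon.2.2.1, if_neg hcon.2.2.2] at hne
    exact hne rfl
  · rintro (rfl | rfl | rfl | rfl) <;> rw [if_pos (rfl : k = k)] <;> omega

variable {E F : Type*} [Field E] [Fintype E] [DecidableEq E] [Field F] [Fintype F] [DecidableEq F]
  [Algebra (ZMod p) E] [Algebra E F] [Algebra (ZMod p) F] [IsScalarTower (ZMod p) E F]

omit [DecidableEq E] [Algebra (ZMod p) E] [IsScalarTower (ZMod p) E F] in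
theorem sumS_eq_sum_normOne (h2 : Module.finrank E F = 2) {t : ℕ} (hE : Fintype.card E = p ^ t)
    {α : Fˣ} (hα : ∀ x : Fˣ, x ∈ Subgroup.zpowers α) :
    sumS p t α = ∑ z : (ZMod p)ˣ, ∑ u ∈ normOne E F,
      ZMod.stdAddChar (N := p) (z * Algebra.trace (ZMod p) F u) := by
  refine sum_congr rfl fun z _ => ?_
  have h := finsum_zpowers_eq_sum_normOne h2 hα
    (fun u => canonicalChar p F (algebraMap (ZMod p) F (z : ZMod p) * u))
  rw [hE] at h
  refine Eq.trans h (sum_congr rfl fun u _ => ?_)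
  simp only [canonicalChar, AddChar.compAddMonoidHom_apply, LinearMap.toAddMonoidHom_coe]
  rw [← Algebra.smul_def, map_smul, smul_eq_mul]

omit [DecidableEq E] [Algebra (ZMod p) E] [IsScalarTower (ZMod p) E F] in
theorem sumS_eq_traceZeroCount (h2 : Module.finrank E F = 2) {t : ℕ}
    (hE : Fintype.card E = p ^ t) {α : Fˣ} (hα : ∀ x : Fˣ, x ∈ Subgroup.zpowers α) :
    sumS p t α = (p : ℂ) * traceZeroCount (ZMod p) E F - ((p : ℂ) ^ t + 1) := by
  rw [sumS_eq_sum_normOne h2 hE hα, sum_sum_normOne_stdAddChar h2, hE, Nat.cast_pow]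

theorem sumS_eq_sum_kloosterman (h2 : Module.finrank E F = 2) {t : ℕ} (ht : 0 < t)
    (hE : Fintype.card E = p ^ t) {α : Fˣ} (hα : ∀ x : Fˣ, x ∈ Subgroup.zpowers α) :
    sumS p t α = ∑ i ∈ Finset.range (t / 2 + 1),
      (-1 : ℂ) ^ (t - i) * ((t : ℂ) / ((t : ℂ) - (i : ℂ))) * ((t - i).choose i : ℂ) * (p : ℂ) ^ i *
        ∑ z : (ZMod p)ˣ, kloosterman p (ZMod p) ((z : ZMod p) ^ 2) ^ (t - 2 * i) := by
  have hn : Module.finrank (ZMod p) E = t := by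
    rw [card_eq_pow_finrank_zmod (p := p)] at hE
    exact Nat.pow_right_injective (Fact.out : p.Prime).two_le hE
  rw [sumS_eq_sum_normOne h2 hE hα]
  simp only [sum_normOne_stdAddChar_eq_dicksonValue h2, hn, neg_one_pow_mul_dicksonValue _ _ ht,
    kloosterman_sq, mul_sum]
  rw [sum_comm]

end WeightDistribution

/-! ### The weight distribution -/

section Parameters

/-- The numbers `M₁, …, M₄` of solutions that determine the weights `B (Q ^ 2 - M)` are smaller
than `Q ^ 2`, and at most `M₂` and `M₃` coincide. -/
theorem solutionCount_lt_and_ne {p g Q N M₃ M₄ : ℕ} (hp : 2 ≤ p) (hg : 2 ≤ g) (hQ : Q = p * g)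
    (hN0 : 0 < N) (hN1 : N ≠ 1) (hNQ : N < Q + 1) (hNg : N ≠ g) (h3 : M₃ + N = 1 + Q * g + Q)
    (h4 : M₄ + N = 1 + Q * g) :
    (Q * g < Q ^ 2 ∧ 1 + (Q - 1) * N < Q ^ 2 ∧ M₃ < Q ^ 2 ∧ M₄ < Q ^ 2) ∧
      (Q * g ≠ 1 + (Q - 1) * N ∧ Q * g ≠ M₃ ∧ Q * g ≠ M₄ ∧ 1 + (Q - 1) * N ≠ M₄ ∧ M₃ ≠ M₄) ∧
      (1 + (Q - 1) * N = M₃ ↔ N = g + 1) := by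
  have h2g : 2 * g ≤ Q := hQ ▸ Nat.mul_le_mul_right g hp
  obtain ⟨R, rfl⟩ : ∃ R, Q = R + 1 := ⟨Q - 1, by omega⟩
  rw [Nat.add_sub_cancel]
  have hR : 0 < R := by omega
  refine ⟨⟨?_, ?_, ?_, ?_⟩, ⟨?_, ?_, ?_, ?_, ?_⟩, ?_⟩
  · nlinarith
  · nlinarith [Nat.mul_le_mul_left R (Nat.lt_succ_iff.1 hNQ)]
  · nlinarith
  · nlinarith
  · intro h
    rcases le_or_gt N g with hle | hlt
    · have := Nat.mul_le_mul_left R hle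
      nlinarith
    · have := Nat.mul_le_mul_left R (Nat.succ_le_of_lt hlt)
      nlinarith
  · omega
  · omega
  · intro h
    apply hNg
    have : (R + 1) * N = (R + 1) * g := by nlinarith
    exact Nat.eq_of_mul_eq_mul_left (by omega) this
  · omega
  · constructor
    · intro h
      have : (R + 1) * N = (R + 1) * (g + 1) := by nlinarith
      exact Nat.eq_of_mul_eq_mul_left (by omega) this
    · rintro rfl
      nlinarith

end Parameters

section MainResults

variable {p : ℕ} [Fact p.Prime]
  {E F : Type*} [Field E] [Fintype E] [DecidableEq E] [Field F] [Fintype F] [DecidableEq F]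
  [Algebra (ZMod p) E] [Algebra E F] [Algebra (ZMod p) F] [IsScalarTower (ZMod p) E F]

/-- The weights and multiplicities of the code in terms of the number `N` of norm-one elements of
trace zero. -/
theorem codeMap_injective_and_weightCount (h2 : Module.finrank E F = 2) {n : ℕ} (hn : 2 ≤ n)
    (hE : Fintype.card E = p ^ (n + 1)) {N M₃ M₄ w₁ w₂ w₃ w₄ : ℕ}
    (hN : N = traceZeroCount (ZMod p) E F)
    (h3 : M₃ + N = 1 + p ^ (n + 1) * p ^ n + p ^ (n + 1))
    (h4 : M₄ + N = 1 + p ^ (n + 1) * p ^ n)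
    (hw₁ : w₁ + p ^ (2 * n + 1) * (p ^ (n + 1) * p ^ n) = p ^ (2 * (2 * n + 1) + 1))
    (hw₂ : w₂ + p ^ (2 * n + 1) * (1 + (p ^ (n + 1) - 1) * N) = p ^ (2 * (2 * n + 1) + 1))
    (hw₃ : w₃ + p ^ (2 * n + 1) * M₃ = p ^ (2 * (2 * n + 1) + 1))
    (hw₄ : w₄ + p ^ (2 * n + 1) * M₄ = p ^ (2 * (2 * n + 1) + 1))
    (hpos : 0 < w₁ ∧ 0 < w₂ ∧ 0 < w₃ ∧ 0 < w₄) :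
    Function.Injective (codeMap (p := p) (definingSet p (n + 1) F)) ∧
      ∀ k, weightCount (codeOf p (definingSet p (n + 1) F)) k =
      (if k = 0 then 1 else 0) +
      (if k = w₁ then p ^ (2 * n + 2) * (p ^ (2 * n + 2) - p) + (p ^ (2 * n + 2) - 1) else 0) +
      (if k = w₂ then p - 1 else 0) +
      (if k = w₃ then (p - 1) * ((p ^ (n + 1) - 1) * N) else 0) +
      (if k = w₄ then (p - 1) * ((p ^ (n + 1) - 1) * (p ^ (n + 1) + 1 - N)) else 0) := by
  have hp2 := (Fact.out : p.Prime).two_le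
  have hQ2 : 2 ≤ p ^ (n + 1) := hp2.trans (Nat.le_self_pow (by omega) p)
  have hF : Fintype.card F = p ^ (2 * n + 1 + 1) := by
    rw [Module.card_eq_pow_finrank (K := E) (V := F), h2, hE, ← pow_mul]
    congr 1
    ring
  set f : F → F → ℕ := fun a b => hammingNorm (codeMap (p := p) (definingSet p (n + 1) F) (a, b))
    with hf
  have hsum : ∀ a b, f a b + zeroCount p (p ^ (n + 1) - 1) a b = p ^ (2 * (2 * n + 1) + 1) :=
    hammingNorm_codeMap_add_zeroCount hF hQ2
  have hB : p ^ (2 * (2 * n + 1)) = p ^ (2 * n + 1) * (p ^ (n + 1) * p ^ n) := by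
    rw [← pow_add, ← pow_add]
    congr 1
    ring
  have e0 : f 0 0 = 0 := by
    simp only [hf]
    rw [Prod.mk_zero_zero, map_zero, hammingNorm_zero]
  have e1 : ∀ b, b ≠ 0 → f 0 b = w₁ := by
    intro b hb
    have := hsum 0 b
    rw [zeroCount_zero hF hb, hB] at this
    omega
  have e1' : ∀ a b, (∀ c : ZMod p, algebraMap (ZMod p) F c ≠ a) → f a b = w₁ := by
    intro a b ha
    have := hsum a b
    rw [zeroCount_of_forall_ne hF b ha, hB] at this
    omega
  -- `y = 0` is a solution as well, since the exponent is positive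
  have hcard : #{y : F | Algebra.trace (ZMod p) F (y ^ (p ^ (n + 1) - 1)) = 0} =
      1 + (p ^ (n + 1) - 1) * N := by
    rw [card_filter_eq_card_units_add, if_pos (by rw [zero_pow (by omega), map_zero]), ← hE,
      card_units_trace_pow_eq_zero h2, hN, add_comm]
  have e2 : ∀ c : ZMod p, c ≠ 0 → f (algebraMap (ZMod p) F c) 0 = w₂ := by
    intro c hc
    have := hsum (algebraMap (ZMod p) F c) 0
    rw [zeroCount_algebraMap hF] at this
    simp only [zero_mul, map_zero, zero_eq_mul, or_iff_right hc] at this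
    rw [hcard] at this
    omega
  have e3 : ∀ (c : ZMod p) (b : F), c ≠ 0 → b ≠ 0 →
      Algebra.trace (ZMod p) F (b ^ (p ^ (n + 1) - 1)) = 0 →
      f (algebraMap (ZMod p) F c) b = w₃ := by
    intro c b hc hb hT
    have h5 := hsum (algebraMap (ZMod p) F c) b
    have h6 := card_trace_mul_eq_add_traceZeroCount h2 hE hc hb
    rw [hE, if_pos hT, ← hN] at h6
    rw [zeroCount_algebraMap hF, show #{y : F | _} = M₃ by omega] at h5
    omega
  have e4 : ∀ (c : ZMod p) (b : F), c ≠ 0 → b ≠ 0 →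
      ¬ Algebra.trace (ZMod p) F (b ^ (p ^ (n + 1) - 1)) = 0 →
      f (algebraMap (ZMod p) F c) b = w₄ := by
    intro c b hc hb hT
    have h5 := hsum (algebraMap (ZMod p) F c) b
    have h6 := card_trace_mul_eq_add_traceZeroCount h2 hE hc hb
    rw [hE, if_neg hT, ← hN] at h6
    rw [zeroCount_algebraMap hF, show #{y : F | _} = M₄ by omega] at h5
    omega
  have hinj : Function.Injective (codeMap (p := p) (definingSet p (n + 1) F)) := by
    rw [injective_iff_map_eq_zero]
    rintro ⟨a, b⟩ hab
    have hfab : f a b = 0 := by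
      simp only [hf]
      rw [hab, hammingNorm_zero]
    by_cases ha : ∀ c : ZMod p, algebraMap (ZMod p) F c ≠ a
    · have := e1' a b ha
      omega
    push Not at ha
    obtain ⟨c, rfl⟩ := ha
    by_cases hc : c = 0
    · subst hc
      rw [map_zero] at hfab ⊢
      by_cases hb : b = 0
      · rw [hb, Prod.mk_zero_zero]
      · have := e1 b hb
        omega
    by_cases hb : b = 0
    · subst hb
      have := e2 c hc
      omega
    by_cases hT : Algebra.trace (ZMod p) F (b ^ (p ^ (n + 1) - 1)) = 0
    · have := e3 c b hc hb hT
      omega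
    · have := e4 c b hc hb hT
      omega
  refine ⟨hinj, fun k => ?_⟩
  have hT := card_units_trace_pow_eq_zero (p := p) h2
  have hT' := card_filter_add_card_filter_not (s := (univ : Finset Fˣ))
    (fun y : Fˣ => Algebra.trace (ZMod p) F ((y : F) ^ (p ^ (n + 1) - 1)) = 0)
  rw [hE, ← hN] at hT
  rw [hT, card_univ, Fintype.card_units, hF] at hT'
  have hNlt := traceZeroCount_lt (p := p) h2
  rw [← hN, hE] at hNlt
  have hsq : p ^ (2 * n + 1 + 1) - 1 = (p ^ (n + 1) - 1) * (p ^ (n + 1) + 1) := by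
    have h := Nat.sq_sub_sq (p ^ (n + 1)) 1
    rw [one_pow, ← pow_mul] at h
    rw [mul_comm (p ^ (n + 1) - 1), ← h]
    congr 2
    ring
  have hnot : #{y : Fˣ | ¬ Algebra.trace (ZMod p) F ((y : F) ^ (p ^ (n + 1) - 1)) = 0} =
      (p ^ (n + 1) - 1) * (p ^ (n + 1) + 1 - N) := by
    rw [Nat.mul_sub, ← hsq]
    omega
  rw [weightCount_codeOf hinj, card_filter_eq_of_classes e0 e1 e1' e2 e3 e4, hT, hnot, hF]

end MainResults

end KloostermanCode


open KloostermanCode in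
theorem mainTheorem1 (p t m : ℕ) [Fact p.Prime] (ht : 2 < t) (hm : m = 2 * t)
    {F : Type*} [Field F] [Fintype F] [DecidableEq F] [Algebra (ZMod p) F]
    (hF : Fintype.card F = p ^ m)
    (α : Fˣ) (hα : ∀ x : Fˣ, x ∈ Subgroup.zpowers α)
    (S : ℂ) (hS : S = KloostermanCode.sumS p t α)
    (C : Submodule (ZMod p) (KloostermanCode.definingSet p t F → ZMod p))
    (hC : C = KloostermanCode.codeOf p (KloostermanCode.definingSet p t F)) :
    -- length and dimension
    (KloostermanCode.definingSet p t F).card = p ^ (2 * m - 1) - 1 ∧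
    Module.finrank (ZMod p) C = 2 * m ∧
    -- the value of `S` through Kloosterman sums over the prime field
    S = ∑ i ∈ Finset.range (t / 2 + 1),
      (-1 : ℂ) ^ (t - i) * ((t : ℂ) / ((t : ℂ) - (i : ℂ))) * ((t - i).choose i : ℂ) * (p : ℂ) ^ i *
        ∑ z : (ZMod p)ˣ, KloostermanCode.kloosterman p (ZMod p) ((z : ZMod p) ^ 2) ^ (t - 2 * i) ∧
    -- the weight distribution
    (∃ w₁ w₂ w₃ w₄ A₁ A₂ A₃ A₄ : ℕ,
      (w₁ : ℂ) = (p : ℂ) ^ (2 * m - 2) * (p - 1) ∧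
      (w₂ : ℂ) = ((p : ℂ) ^ (2 * m - 2) - (p : ℂ) ^ (m - 2)) * (p - 1)
        - (p : ℂ) ^ (m - 2) * ((p : ℂ) ^ t - 1) * S ∧
      (w₃ : ℂ) = ((p : ℂ) ^ (2 * m - 2) - (p : ℂ) ^ (m - 2)) * (p - 1)
        - (p : ℂ) ^ (m - 2) * ((p : ℂ) ^ t * (p - 1) - S) ∧
      (w₄ : ℂ) = ((p : ℂ) ^ (2 * m - 2) - (p : ℂ) ^ (m - 2)) * (p - 1)
        + (p : ℂ) ^ (m - 2) * ((p : ℂ) ^ t + S) ∧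
      (A₁ : ℂ) = (p : ℂ) ^ m * ((p : ℂ) ^ m - p + 1) - 1 ∧
      (A₂ : ℂ) = (p : ℂ) - 1 ∧
      (A₃ : ℂ) = (((p : ℂ) - 1) * ((p : ℂ) ^ m - 1)
        + ((p : ℂ) ^ (t + 1) - (p : ℂ) ^ t - p + 1) * S) / p ∧
      (A₄ : ℂ) = (((p : ℂ) ^ 2 - 2 * p + 1) * ((p : ℂ) ^ m - 1)
        - ((p : ℂ) ^ (t + 1) - (p : ℂ) ^ t - p + 1) * S) / p ∧
      (0 < w₁ ∧ 0 < w₂ ∧ 0 < w₃ ∧ 0 < w₄) ∧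
      (0 < A₁ ∧ 0 < A₂ ∧ 0 < A₃ ∧ 0 < A₄) ∧
      ∀ k : ℕ, KloostermanCode.weightCount C k =
        (if k = 0 then 1 else 0) + (if k = w₁ then A₁ else 0) + (if k = w₂ then A₂ else 0)
          + (if k = w₃ then A₃ else 0) + (if k = w₄ then A₄ else 0)) ∧
    -- number of nonzero weights; for `S = p - 1` the weights `w₂` and `w₃` coincide
    (S ≠ (p : ℂ) - 1 → KloostermanCode.IsWeightCode 4 C) ∧
    (S = (p : ℂ) - 1 → KloostermanCode.IsWeightCode 3 C) := by
  have hp2 := (Fact.out : p.Prime).two_le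
  subst hm hS hC
  obtain ⟨n, rfl⟩ : ∃ n, t = n + 1 := ⟨t - 1, by omega⟩
  have hn : 2 ≤ n := by omega
  have hfinF : Module.finrank (ZMod p) F = 2 * (n + 1) := by
    rw [card_eq_pow_finrank_zmod (p := p)] at hF
    exact Nat.pow_right_injective hp2 hF
  have hfinE : Module.finrank (ZMod p) (GaloisField p (n + 1)) = n + 1 :=
    GaloisField.finrank p (by omega)
  -- the intermediate field of order `p ^ t` is realized by an embedding of `GaloisField p t`
  obtain ⟨φ⟩ := FiniteField.nonempty_algHom_of_finrank_dvd (F := ZMod p)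
    (K := GaloisField p (n + 1)) (L := F) (by rw [hfinE, hfinF]; exact dvd_mul_left _ _)
  let _ : Algebra (GaloisField p (n + 1)) F := φ.toRingHom.toAlgebra
  have : IsScalarTower (ZMod p) (GaloisField p (n + 1)) F :=
    IsScalarTower.of_algebraMap_eq fun x => (φ.commutes x).symm
  let _ : Fintype (GaloisField p (n + 1)) := Fintype.ofFinite _
  let _ : DecidableEq (GaloisField p (n + 1)) := Classical.decEq _
  have h2 : Module.finrank (GaloisField p (n + 1)) F = 2 := by
    have := Module.finrank_mul_finrank (ZMod p) (GaloisField p (n + 1)) F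
    rw [hfinE, hfinF, mul_comm] at this
    exact Nat.eq_of_mul_eq_mul_right (Nat.succ_pos n) this
  have hE : Fintype.card (GaloisField p (n + 1)) = p ^ (n + 1) := by
    rw [card_eq_pow_finrank_zmod (p := p), hfinE]
  have hSN := sumS_eq_traceZeroCount h2 hE hα
  have hSK := sumS_eq_sum_kloosterman h2 (Nat.succ_pos n) hE hα
  have hN0 := traceZeroCount_pos (p := p) h2 (by omega)
  have hN1 := traceZeroCount_ne_one (p := p) h2 (by omega)
  have hNg := traceZeroCount_ne_pow (p := p) h2 (n := n) (by omega)
  have hNQ := traceZeroCount_lt (p := p) h2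
  rw [hE] at hNQ
  obtain ⟨N, hN⟩ : ∃ N, N = traceZeroCount (ZMod p) (GaloisField p (n + 1)) F := ⟨_, rfl⟩
  rw [← hN] at hSN hN0 hN1 hNg hNQ
  have hg2 : 2 ≤ p ^ n := hp2.trans (Nat.le_self_pow (by omega) p)
  obtain ⟨M₃, h3⟩ : ∃ M, M + N = 1 + p ^ (n + 1) * p ^ n + p ^ (n + 1) :=
    ⟨1 + p ^ (n + 1) * p ^ n + p ^ (n + 1) - N, by omega⟩
  obtain ⟨M₄, h4⟩ : ∃ M, M + N = 1 + p ^ (n + 1) * p ^ n :=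
    ⟨1 + p ^ (n + 1) * p ^ n - N, by
      have := Nat.le_mul_of_pos_right (p ^ (n + 1)) (show 0 < p ^ n by omega)
      omega⟩
  obtain ⟨⟨l1, l2, l3, l4⟩, ⟨n12, n13, n14, n24, n34⟩, h23⟩ :=
    solutionCount_lt_and_ne hp2 hg2 (pow_succ' p n) hN0 hN1 hNQ hNg h3 h4
  -- a number `M` of solutions gives the weight `p ^ (m - 1) * (p ^ m - M)`
  have hwt : ∀ M, M < (p ^ (n + 1)) ^ 2 →
      ∃ w, w + p ^ (2 * n + 1) * M = p ^ (2 * (2 * n + 1) + 1) ∧ 0 < w := by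
    intro M hM
    refine ⟨p ^ (2 * n + 1) * ((p ^ (n + 1)) ^ 2 - M), ?_,
      Nat.mul_pos (pow_pos (by omega) _) (by omega)⟩
    rw [← mul_add, Nat.sub_add_cancel hM.le, ← pow_mul, ← pow_add]
    congr 1
    ring
  obtain ⟨w₁, hw₁, pos₁⟩ := hwt _ l1
  obtain ⟨w₂, hw₂, pos₂⟩ := hwt _ l2
  obtain ⟨w₃, hw₃, pos₃⟩ := hwt _ l3
  obtain ⟨w₄, hw₄, pos₄⟩ := hwt _ l4
  have hpos : 0 < w₁ ∧ 0 < w₂ ∧ 0 < w₃ ∧ 0 < w₄ := ⟨pos₁, pos₂, pos₃, pos₄⟩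
  obtain ⟨hinj, hcount⟩ := codeMap_injective_and_weightCount h2 hn hE hN h3 h4 hw₁ hw₂ hw₃ hw₄ hpos
  have hQ : 2 ≤ p ^ (n + 1) := hp2.trans (Nat.le_self_pow (by omega) p)
  have hpQ : p < p ^ (2 * n + 2) := by
    calc p = p ^ 1 := (pow_one p).symm
      _ < p ^ (2 * n + 2) := Nat.pow_lt_pow_right (by omega) (by omega)
  have hApos : 0 < p ^ (2 * n + 2) * (p ^ (2 * n + 2) - p) + (p ^ (2 * n + 2) - 1) ∧ 0 < p - 1 ∧
      0 < (p - 1) * ((p ^ (n + 1) - 1) * N) ∧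
      0 < (p - 1) * ((p ^ (n + 1) - 1) * (p ^ (n + 1) + 1 - N)) := by
    have h1 : 0 < p - 1 := by omega
    have h2 : 0 < p ^ (n + 1) - 1 := by omega
    have h3 : 0 < p ^ (n + 1) + 1 - N := by omega
    have h4 : 0 < p ^ (2 * n + 2) - 1 := by omega
    exact ⟨by omega, h1, by positivity, by positivity⟩
  have hset := setOf_weightCount_ne_zero hpos hApos hcount
  have hpC : (p : ℂ) ≠ 0 := Nat.cast_ne_zero.2 (by omega)
  have hne : ∀ {w w' M M' : ℕ}, w + p ^ (2 * n + 1) * M = p ^ (2 * (2 * n + 1) + 1) →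
      w' + p ^ (2 * n + 1) * M' = p ^ (2 * (2 * n + 1) + 1) → (w = w' ↔ M = M') := by
    intro w w' M M' h h'
    constructor
    · rintro rfl
      exact Nat.eq_of_mul_eq_mul_left (pow_pos (by omega) (2 * n + 1))
        (Nat.add_left_cancel (h.trans h'.symm))
    · rintro rfl
      omega
  have hSiff : sumS p (n + 1) α = (p : ℂ) - 1 ↔ w₂ = w₃ := by
    rw [hne hw₂ hw₃, h23, hSN]
    constructor
    · intro h
      have h5 : (p : ℂ) * N = p * ((p ^ n + 1 : ℕ) : ℂ) := by
        push_cast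
        linear_combination h
      exact_mod_cast mul_left_cancel₀ hpC h5
    · rintro rfl
      push_cast
      ring
  have k12 : w₁ ≠ w₂ := fun h => n12 ((hne hw₁ hw₂).1 h)
  have k13 : w₁ ≠ w₃ := fun h => n13 ((hne hw₁ hw₃).1 h)
  have k14 : w₁ ≠ w₄ := fun h => n14 ((hne hw₁ hw₄).1 h)
  have k24 : w₂ ≠ w₄ := fun h => n24 ((hne hw₂ hw₄).1 h)
  have k34 : w₃ ≠ w₄ := fun h => n34 ((hne hw₃ hw₄).1 h)
  have hQ1 : ((p ^ (n + 1) - 1 : ℕ) : ℂ) = (p : ℂ) ^ (n + 1) - 1 := by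
    rw [Nat.cast_sub (by omega), Nat.cast_pow, Nat.cast_one]
  have h3C := congrArg (Nat.cast (R := ℂ)) h3
  have h4C := congrArg (Nat.cast (R := ℂ)) h4
  have c₁ := congrArg (Nat.cast (R := ℂ)) hw₁
  have c₂ := congrArg (Nat.cast (R := ℂ)) hw₂
  have c₃ := congrArg (Nat.cast (R := ℂ)) hw₃
  have c₄ := congrArg (Nat.cast (R := ℂ)) hw₄
  simp only [Nat.cast_add, Nat.cast_mul, Nat.cast_pow, hQ1, Nat.cast_one] at h3C h4C c₁ c₂ c₃ c₄
  have hcardD := card_definingSet_add_one (p := p) (F := F) (m := 2 * n + 1) (t := n + 1)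
    (by rw [hF]; congr 1) hQ
  refine ⟨?_, ?_, hSK, ?_, ?_, ?_⟩
  · rw [show 2 * (2 * (n + 1)) - 1 = 2 * (2 * n + 1) + 1 by omega]
    omega
  · rw [codeOf_eq_range, LinearMap.finrank_range_of_inj hinj, Module.finrank_prod, hfinF]
    ring
  · refine ⟨w₁, w₂, w₃, w₄, _, _, _, _, ?_, ?_, ?_, ?_, ?_, ?_, ?_, ?_, hpos, hApos, hcount⟩
    all_goals
      try rw [show 2 * (2 * (n + 1)) - 2 = 4 * n + 2 by omega]
      try rw [show 2 * (n + 1) - 2 = 2 * n by omega]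
      try rw [hSN]
    · linear_combination c₁
    · linear_combination c₂
    · linear_combination c₃ - (p : ℂ) ^ (2 * n + 1) * h3C
    · linear_combination c₄ - (p : ℂ) ^ (2 * n + 1) * h4C
    · rw [Nat.cast_add, Nat.cast_mul, Nat.cast_sub hpQ.le, Nat.cast_sub (by omega)]
      push_cast
      ring
    · rw [Nat.cast_sub (by omega), Nat.cast_one]
    · rw [Nat.cast_mul, Nat.cast_mul, Nat.cast_sub (by omega), Nat.cast_sub (by omega)]
      push_cast
      field_simp
      ring
    · rw [Nat.cast_mul, Nat.cast_mul, Nat.cast_sub (by omega), Nat.cast_sub (by omega),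
        Nat.cast_sub (by omega)]
      push_cast
      field_simp
      ring
  · intro hSne
    rw [IsWeightCode, hset, Set.ncard_coe_finset]
    have k23 : w₂ ≠ w₃ := fun h => hSne (hSiff.2 h)
    rw [Finset.card_insert_of_notMem (by simp [k12, k13, k14]),
      Finset.card_insert_of_notMem (by simp [k23, k24]), Finset.card_pair k34]
  · intro hSeq
    rw [IsWeightCode, hset, Set.ncard_coe_finset, hSiff.1 hSeq,
      Finset.insert_eq_of_mem (Finset.mem_insert_self w₃ {w₄}),
      Finset.card_insert_of_notMem (by simp [k13, k14]), Finset.card_pair k34]
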